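/- Let $n\ge 1$, let $\mathbb B^n$ be the open unit ball of $\mathbb R^n$ and $\overline{\mathbb B^n}$ its closure. For $x\in\mathbb B^n$ and $y\in\overline{\mathbb B^n}$ put $$T_x(y)=\frac{(1+2x\cdot y+|y|^2)\,x+(1-|x|^2)\,y}{1+2x\cdot y+|x|^2|y|^2}\in\overline{\mathbb B^n}.$$ Let $g:[0,1]\to\mathbb R$ be continuous with $g(0)=0$, and define $v:\overline{\mathbb B^n}\to\mathbb R^n$ by $v(y)=g(|y|)\,y/|y|$ for $y\ne 0$ and $v(0)=0$. For a finite (positive) Borel measure $\mu$ on $\overline{\mathbb B^n}$ put $$V_\mu(x)=\int_{\overline{\mathbb B^n}} v(T_x(y))\,d\mu(y),\qquad x\in\mathbb B^n.$$ Hyperbolic geodesics of $\mathbb B^n$ are the intersections with $\mathbb B^n$ of straight lines through the origin and of circles meeting the unit sphere at right angles; their closures are Euclidean closures. Saying that $\mu$ is not supported in the closure of a hyperbolic geodesic means that $\mu(\overline{\mathbb B^n}\setminus\overline\gamma)>0$ for every hyperbolic geodesic $\gamma$. "Increasing" means weakly increasing. Assume that $0<\mu(\overline{\mathbb B^n})<\infty$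 and $$\mu(\{y\})<\tfrac12\,\mu(\overline{\mathbb B^n})\qquad\text{for all } y\in\partial\mathbb B^n. \tag{1}$$ (a) (Existence) If $g(1)>0$, then $V_\mu(x_c)=0$ for some $x_c\in\mathbb B^n$. (b) (Uniqueness) If either (i) $g$ is strictly increasing on $[0,1]$, or (ii) $g$ is increasing on $[0,1]$, $g(r)>0$ for $0<r<1$, and $\mu$ is not supported in the closure of a hyperbolic geodesic, then there is exactly one point $x_c=x_c(\mu)\in\mathbb B^n$ with $V_\mu(x_c)=0$. (c) (Continuous dependence) Let $\mu_k$ ($k\in\mathbb N$) be Borel measures on $\overline{\mathbb B^n}$ with $0<\mu_k(\overline{\mathbb B^n})<\infty$, each satisfying (1) with $\mu_k$ in place of $\mu$, and suppose that $\mu_k\to\mu$ weakly, i.e. $\int f\,d\mu_k\to\int f\,d\mu$ for every continuous $f:\overline{\mathbb B^n}\to\mathbb R$. If (i) holds, or if (ii) holds for $\mu$ and for every $\mu_k$, then $x_c(\mu_k)\to x_c(\mu)$ as $k\to\infty$. -/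

import Mathlib

open MeasureTheory Filter Topology

namespace HypCenter

/-- The closed unit ball of Euclidean `n`-space, as a topological (and Borel) space. -/
abbrev ClosedUnitBall (n : ℕ) : Type :=
  Metric.closedBall (0 : EuclideanSpace ℝ (Fin n)) 1

/-- The Möbius transformation `T_x(y)` of the ball, by its explicit formula.
For `‖x‖ < 1` and `‖y‖ ≤ 1` the denominator is positive. -/
noncomputable def moebius {n : ℕ} (x y : EuclideanSpace ℝ (Fin n)) :
    EuclideanSpace ℝ (Fin n) :=
  (1 + 2 * inner ℝ x y + ‖x‖ ^ 2 * ‖y‖ ^ 2)⁻¹ •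
    ((1 + 2 * inner ℝ x y + ‖y‖ ^ 2) • x + (1 - ‖x‖ ^ 2) • y)

open Classical in
/-- The radial vector field `v(y) = g(|y|) y / |y|`, with `v(0) = 0`. -/
noncomputable def radialField {n : ℕ} (g : ℝ → ℝ) (y : EuclideanSpace ℝ (Fin n)) :
    EuclideanSpace ℝ (Fin n) :=
  if y = 0 then 0 else g ‖y‖ • (‖y‖⁻¹ • y)

/-- The vector field `V(x) = ∫ v(T_x(y)) dμ(y)`, the integral being over the closed ball. -/
noncomputable def centerField {n : ℕ} (g : ℝ → ℝ) (μ : FiniteMeasure (ClosedUnitBall n))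
    (x : EuclideanSpace ℝ (Fin n)) : EuclideanSpace ℝ (Fin n) :=
  ∫ y : ClosedUnitBall n, radialField g (moebius x y) ∂(μ : Measure (ClosedUnitBall n))

/-- `x` is a zero of `V` in the open unit ball. -/
def IsCenter {n : ℕ} (g : ℝ → ℝ) (μ : FiniteMeasure (ClosedUnitBall n))
    (x : EuclideanSpace ℝ (Fin n)) : Prop :=
  x ∈ Metric.ball (0 : EuclideanSpace ℝ (Fin n)) 1 ∧ centerField g μ x = 0

/-- Complete hyperbolic geodesics of the open unit ball: the open diameters, and the arcs
inside the ball of the circles that meet the unit sphere at right angles. A circle with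
center `c` and radius `R`, lying in a plane through the origin, is orthogonal to
the unit sphere exactly when `‖c‖ ^ 2 = 1 + R ^ 2`; a circle that meets the unit sphere at a
right angle always lies in such a plane, because its tangent there is radial. -/
def IsHypGeodesic {n : ℕ} (γ : Set (EuclideanSpace ℝ (Fin n))) : Prop :=
  (∃ L : Submodule ℝ (EuclideanSpace ℝ (Fin n)), Module.finrank ℝ L = 1 ∧
    γ = (L : Set (EuclideanSpace ℝ (Fin n))) ∩ Metric.ball 0 1) ∨
  (∃ (P : Submodule ℝ (EuclideanSpace ℝ (Fin n))) (c : EuclideanSpace ℝ (Fin n)) (R : ℝ),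
    Module.finrank ℝ P = 2 ∧ c ∈ P ∧ 0 < R ∧ ‖c‖ ^ 2 = 1 + R ^ 2 ∧
    γ = (P : Set (EuclideanSpace ℝ (Fin n))) ∩ Metric.sphere c R ∩ Metric.ball 0 1)

/-- `μ` is not supported in the (Euclidean) closure of a hyperbolic geodesic. -/
def NotInGeodesicClosure {n : ℕ} (μ : FiniteMeasure (ClosedUnitBall n)) : Prop :=
  ∀ γ : Set (EuclideanSpace ℝ (Fin n)), IsHypGeodesic γ →
    0 < μ {y : ClosedUnitBall n | (y : EuclideanSpace ℝ (Fin n)) ∉ closure γ}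

/-- `μ` has positive total mass, and every point of the unit sphere
carries less than half of the total mass. -/
def Admissible {n : ℕ} (μ : FiniteMeasure (ClosedUnitBall n)) : Prop :=
  0 < μ Set.univ ∧
  ∀ y : ClosedUnitBall n, ‖(y : EuclideanSpace ℝ (Fin n))‖ = 1 → μ {y} < μ Set.univ / 2

/-- Condition (i): `g` is strictly increasing on `[0, 1]`. -/
def CondI (g : ℝ → ℝ) : Prop := StrictMonoOn g (Set.Icc 0 1)

/-- Condition (ii): `g` is (weakly) increasing on `[0, 1]` and positive on `(0, 1)`, and `μ` is
not supported in the closure of a hyperbolic geodesic. -/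
def CondII {n : ℕ} (g : ℝ → ℝ) (μ : FiniteMeasure (ClosedUnitBall n)) : Prop :=
  MonotoneOn g (Set.Icc 0 1) ∧ (∀ r ∈ Set.Ioo (0 : ℝ) 1, 0 < g r) ∧ NotInGeodesicClosure μ

end HypCenter

/-! Geometrically, `moebius x y` is the point `y` seen from the base point `-x`: it sends `-x` to
`0`, and for interior `y` its norm is tanh of half the hyperbolic distance from `-x` to `y`. A
center is thus an `x` for which radial pulls of strength `g` exerted at `-x` by the mass cancel.

Uniqueness. Given two zeros, consider the hyperbolic triangle with vertices `-x₁`, `-x₂`, `y`. The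
pulls at `-x₁` and `-x₂`, each projected on the direction of the other base point, add up to a
multiple of g(t₁) cos α + g(t₂) cos β (`pairing`). At most one angle is obtuse; the side opposite to
it is the longer one and α + β ≤ π, so the sum is nonnegative for monotone `g` (`weighted_cos_sum`,
`pairing_spec`). It integrates to zero, hence vanishes almost everywhere. This puts the mass on one
closed geodesic, which contradicts (ii); under (i) it even puts the mass on the two endpoints, which
contradicts the bound on boundary atoms (`center_unique`).

Existence. For profiles r(a + (1 - r²) q(r²)) with a > 0 the field is, up to a positive factor, the
gradient of an energy built from a Busemann-type function. Less than half of the mass lies near any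
boundary point, so the energy blows up at the sphere and has an interior minimum
(`exists_center_profile`). Such profiles approximate every `g` uniformly with the value at 1 kept
(`exists_profile_approx`), and the approximate centers converge along a subsequence
(`isCenter_of_tendsto`). The limit is not on the sphere: as `x → z` with `‖z‖ = 1`, all mass except
that at `-z` is pushed to `z`, so the component along `z` cannot vanish
(`not_tendsto_boundary_of_approx`).

Continuity is the same compactness argument with varying measures, concluded by uniqueness;
monotonicity of `g` controls the mass near `-z` (`not_tendsto_boundary_of_monotone`). -/

namespace HypCenter

variable {n : ℕ}

/-! ### Algebra of the Möbius transformations -/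

/-- The denominator of the Möbius transformation `T_x(y)`. -/
noncomputable def den (x y : EuclideanSpace ℝ (Fin n)) : ℝ :=
  1 + 2 * inner ℝ x y + ‖x‖ ^ 2 * ‖y‖ ^ 2

lemma moebius_eq (x y : EuclideanSpace ℝ (Fin n)) :
    moebius x y = (den x y)⁻¹ •
      ((1 + 2 * inner ℝ x y + ‖y‖ ^ 2) • x + (1 - ‖x‖ ^ 2) • y) := rfl

/-- Shows that, on the closed ball, the denominator can be small only where `y` is near `-x`. -/
lemma den_eq_norm_add_sq (x y : EuclideanSpace ℝ (Fin n)) :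
    den x y = ‖x + y‖ ^ 2 + (1 - ‖x‖ ^ 2) * (1 - ‖y‖ ^ 2) := by
  rw [norm_add_sq_real, den]; ring

lemma one_sub_norm_sq_pos {x : EuclideanSpace ℝ (Fin n)} (hx : ‖x‖ < 1) :
    0 < 1 - ‖x‖ ^ 2 := by
  nlinarith [norm_nonneg x]

lemma one_sub_norm_sq_nonneg {x : EuclideanSpace ℝ (Fin n)} (hx : ‖x‖ ≤ 1) :
    0 ≤ 1 - ‖x‖ ^ 2 := by
  nlinarith [norm_nonneg x]

lemma norm_add_sq_le_den {x y : EuclideanSpace ℝ (Fin n)} (hx : ‖x‖ ≤ 1) (hy : ‖y‖ ≤ 1) :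
    ‖x + y‖ ^ 2 ≤ den x y := by
  rw [den_eq_norm_add_sq]
  have := mul_nonneg (one_sub_norm_sq_nonneg hx) (one_sub_norm_sq_nonneg hy)
  linarith

lemma one_sub_norm_sq_le_den {x y : EuclideanSpace ℝ (Fin n)} (hx : ‖x‖ ≤ 1) (hy : ‖y‖ ≤ 1) :
    (1 - ‖x‖) ^ 2 ≤ den x y := by
  have h1 := neg_le_of_abs_le (abs_real_inner_le_norm x y)
  have h2 : ‖x‖ * ‖y‖ ≤ ‖x‖ := mul_le_of_le_one_right (norm_nonneg x) hy
  have h3 : 0 ≤ ‖x‖ * ‖y‖ := by positivity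
  rw [den]
  nlinarith

lemma den_pos {x y : EuclideanSpace ℝ (Fin n)} (hx : ‖x‖ < 1) (hy : ‖y‖ ≤ 1) :
    0 < den x y :=
  lt_of_lt_of_le (by have := sub_pos.2 hx; positivity) (one_sub_norm_sq_le_den hx.le hy)

lemma den_neg_comm (x y : EuclideanSpace ℝ (Fin n)) : den x (-y) = den y (-x) := by
  simp only [den, inner_neg_right, norm_neg, real_inner_comm]
  ring

lemma inner_moebius (x y w : EuclideanSpace ℝ (Fin n)) :
    inner ℝ (moebius x y) (moebius x w) = (den x y)⁻¹ * (den x w)⁻¹ *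
      ((1 + 2 * inner ℝ x y + ‖y‖ ^ 2) * (1 + 2 * inner ℝ x w + ‖w‖ ^ 2) * ‖x‖ ^ 2
        + (1 + 2 * inner ℝ x y + ‖y‖ ^ 2) * (1 - ‖x‖ ^ 2) * inner ℝ x w
        + (1 + 2 * inner ℝ x w + ‖w‖ ^ 2) * (1 - ‖x‖ ^ 2) * inner ℝ x y
        + (1 - ‖x‖ ^ 2) ^ 2 * inner ℝ y w) := by
  simp only [moebius_eq, inner_smul_left, inner_smul_right, inner_add_left, inner_add_right,
    real_inner_self_eq_norm_sq, real_inner_comm x y, RCLike.conj_to_real]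
  ring

lemma norm_moebius_sq (x y : EuclideanSpace ℝ (Fin n)) :
    ‖moebius x y‖ ^ 2 = (den x y)⁻¹ ^ 2 *
      ((1 + 2 * inner ℝ x y + ‖y‖ ^ 2) ^ 2 * ‖x‖ ^ 2
        + 2 * (1 + 2 * inner ℝ x y + ‖y‖ ^ 2) * (1 - ‖x‖ ^ 2) * inner ℝ x y
        + (1 - ‖x‖ ^ 2) ^ 2 * ‖y‖ ^ 2) := by
  rw [← real_inner_self_eq_norm_sq, inner_moebius, real_inner_self_eq_norm_sq y]
  ring

/-- Gives the invariance of the ball and of the sphere, and later the ratio `l` that couples the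
sides of a triangle. -/
lemma one_sub_norm_moebius_sq {x y : EuclideanSpace ℝ (Fin n)} (hx : ‖x‖ < 1) (hy : ‖y‖ ≤ 1) :
    1 - ‖moebius x y‖ ^ 2 = (1 - ‖x‖ ^ 2) * (1 - ‖y‖ ^ 2) / den x y := by
  have h := (den_pos hx hy).ne'
  rw [norm_moebius_sq]
  field_simp
  simp only [den]
  ring

lemma norm_moebius_le_one {x y : EuclideanSpace ℝ (Fin n)} (hx : ‖x‖ < 1) (hy : ‖y‖ ≤ 1) :
    ‖moebius x y‖ ≤ 1 := by
  have h : 0 ≤ 1 - ‖moebius x y‖ ^ 2 := by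
    rw [one_sub_norm_moebius_sq hx hy]
    have := one_sub_norm_sq_nonneg hx.le
    have := one_sub_norm_sq_nonneg hy
    have := den_pos hx hy
    positivity
  nlinarith [norm_nonneg (moebius x y)]

lemma norm_moebius_lt_one {x y : EuclideanSpace ℝ (Fin n)} (hx : ‖x‖ < 1) (hy : ‖y‖ < 1) :
    ‖moebius x y‖ < 1 := by
  have h : 0 < 1 - ‖moebius x y‖ ^ 2 := by
    rw [one_sub_norm_moebius_sq hx hy.le]
    have := one_sub_norm_sq_pos hx
    have := one_sub_norm_sq_pos hy
    have := den_pos hx hy.le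
    positivity
  nlinarith [norm_nonneg (moebius x y)]

lemma norm_moebius_eq_one {x y : EuclideanSpace ℝ (Fin n)} (hx : ‖x‖ < 1) (hy : ‖y‖ = 1) :
    ‖moebius x y‖ = 1 := by
  have h : 1 - ‖moebius x y‖ ^ 2 = 0 := by
    rw [one_sub_norm_moebius_sq hx hy.le, hy]; simp
  nlinarith [norm_nonneg (moebius x y)]

/-- The left side is `den (-T_x w) (T_x y)`, so this is the covariance of `den` under `T_x`. Read
from the base point `-x`, it is the hyperbolic cosine law. -/
lemma one_sub_two_inner_moebius {x y w : EuclideanSpace ℝ (Fin n)} (hx : ‖x‖ < 1)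
    (hy : ‖y‖ ≤ 1) (hw : ‖w‖ ≤ 1) :
    1 - 2 * inner ℝ (moebius x y) (moebius x w) + ‖moebius x y‖ ^ 2 * ‖moebius x w‖ ^ 2 =
      (1 - ‖x‖ ^ 2) ^ 2 * den (-w) y / (den x y * den x w) := by
  have h := (den_pos hx hy).ne'
  have h' := (den_pos hx hw).ne'
  have e1 : ‖moebius x y‖ ^ 2 = 1 - (1 - ‖x‖ ^ 2) * (1 - ‖y‖ ^ 2) / den x y := by
    rw [← one_sub_norm_moebius_sq hx hy]; ring
  have e2 : ‖moebius x w‖ ^ 2 = 1 - (1 - ‖x‖ ^ 2) * (1 - ‖w‖ ^ 2) / den x w := by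
    rw [← one_sub_norm_moebius_sq hx hw]; ring
  rw [e1, e2, inner_moebius]
  field_simp
  simp only [den, inner_neg_left, norm_neg, real_inner_comm y w]
  ring

/-- The factor `1 - ‖x‖²` makes `T_x y` stick to `x` near the sphere as long as the denominator
stays away from zero. -/
lemma moebius_sub {x y : EuclideanSpace ℝ (Fin n)} (hx : ‖x‖ < 1) (hy : ‖y‖ ≤ 1) :
    moebius x y - x = ((1 - ‖x‖ ^ 2) / den x y) • (‖y‖ ^ 2 • x + y) := by
  have h := (den_pos hx hy).ne'
  have hx' : x = (den x y)⁻¹ • (den x y • x) := by rw [smul_smul, inv_mul_cancel₀ h, one_smul]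
  conv_lhs => rw [moebius_eq]; arg 2; rw [hx']
  rw [← smul_sub, div_eq_inv_mul, mul_smul]
  congr 1
  simp only [den]
  module

lemma norm_moebius_sub_le {x y : EuclideanSpace ℝ (Fin n)} (hx : ‖x‖ < 1) (hy : ‖y‖ ≤ 1) :
    ‖moebius x y - x‖ ≤ 2 * (1 - ‖x‖ ^ 2) / den x y := by
  have h := den_pos hx hy
  have h1 := one_sub_norm_sq_pos hx
  rw [moebius_sub hx hy, norm_smul, Real.norm_of_nonneg (by positivity)]
  have h2 : ‖‖y‖ ^ 2 • x + y‖ ≤ 2 := by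
    refine (norm_add_le _ _).trans ?_
    rw [norm_smul, Real.norm_of_nonneg (by positivity)]
    nlinarith [norm_nonneg x, norm_nonneg y, mul_le_one₀ hy (norm_nonneg y) hy]
  calc (1 - ‖x‖ ^ 2) / den x y * ‖‖y‖ ^ 2 • x + y‖ ≤ (1 - ‖x‖ ^ 2) / den x y * 2 := by gcongr
    _ = _ := by ring

lemma moebius_neg_moebius {x y : EuclideanSpace ℝ (Fin n)} (hx : ‖x‖ < 1) (hy : ‖y‖ ≤ 1) :
    moebius (-x) (moebius x y) = y := by
  have h := (den_pos hx hy).ne'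
  have hx1 := (one_sub_norm_sq_pos hx).ne'
  have e2 : ‖moebius x y‖ ^ 2 = 1 - (1 - ‖x‖ ^ 2) * (1 - ‖y‖ ^ 2) / den x y := by
    rw [← one_sub_norm_moebius_sq hx hy]; ring
  have e1 : inner ℝ (-x) (moebius x y) = -((den x y)⁻¹ *
      ((1 + 2 * inner ℝ x y + ‖y‖ ^ 2) * ‖x‖ ^ 2 + (1 - ‖x‖ ^ 2) * inner ℝ x y)) := by
    simp only [moebius_eq, inner_smul_right, inner_add_right, real_inner_self_eq_norm_sq,
      inner_neg_left]
    ring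
  have e3 : den (-x) (moebius x y) = (1 - ‖x‖ ^ 2) ^ 2 / den x y := by
    rw [den, e1, e2, norm_neg]
    field_simp
    simp only [den]
    ring
  have e4 : 1 + 2 * inner ℝ (-x) (moebius x y) + ‖moebius x y‖ ^ 2 =
      (1 - ‖x‖ ^ 2) * (1 + 2 * inner ℝ x y + ‖y‖ ^ 2) / den x y := by
    rw [e1, e2]
    field_simp
    simp only [den]
    ring
  rw [moebius_eq (-x), e3, e4, norm_neg, moebius_eq x y]
  simp only [smul_add, smul_neg, smul_smul]
  have e5 : ((1 - ‖x‖ ^ 2) ^ 2 / den x y)⁻¹ *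
      ((1 - ‖x‖ ^ 2) * (1 + 2 * inner ℝ x y + ‖y‖ ^ 2) / den x y) =
      ((1 - ‖x‖ ^ 2) ^ 2 / den x y)⁻¹ *
        ((1 - ‖x‖ ^ 2) * ((den x y)⁻¹ * (1 + 2 * inner ℝ x y + ‖y‖ ^ 2))) := by ring
  have e6 : ((1 - ‖x‖ ^ 2) ^ 2 / den x y)⁻¹ *
      ((1 - ‖x‖ ^ 2) * ((den x y)⁻¹ * (1 - ‖x‖ ^ 2))) = 1 := by
    field_simp
  rw [e5, e6, one_smul]
  abel

lemma continuousAt_moebius {x y : EuclideanSpace ℝ (Fin n)} (hx : ‖x‖ < 1) (hy : ‖y‖ ≤ 1) :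
    ContinuousAt (fun p : EuclideanSpace ℝ (Fin n) × EuclideanSpace ℝ (Fin n) =>
      moebius p.1 p.2) (x, y) := by
  have h := (den_pos hx hy).ne'
  have h1 : ContinuousAt (fun p : EuclideanSpace ℝ (Fin n) × EuclideanSpace ℝ (Fin n) =>
      (den p.1 p.2)⁻¹) (x, y) := by
    refine ContinuousAt.inv₀ ?_ h
    unfold den
    fun_prop
  have h2 : ContinuousAt (fun p : EuclideanSpace ℝ (Fin n) × EuclideanSpace ℝ (Fin n) =>
      (1 + 2 * inner ℝ p.1 p.2 + ‖p.2‖ ^ 2) • p.1 + (1 - ‖p.1‖ ^ 2) • p.2) (x, y) := by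
    fun_prop
  exact h1.smul h2

lemma continuous_moebius_ball :
    Continuous (fun p : Metric.ball (0 : EuclideanSpace ℝ (Fin n)) 1 × ClosedUnitBall n =>
      moebius (p.1 : EuclideanSpace ℝ (Fin n)) (p.2 : EuclideanSpace ℝ (Fin n))) := by
  rw [continuous_iff_continuousAt]
  rintro ⟨x, y⟩
  have h := continuousAt_moebius (mem_ball_zero_iff.1 x.2) (mem_closedBall_zero_iff.1 y.2)
  have h2 : Tendsto (fun p : Metric.ball (0 : EuclideanSpace ℝ (Fin n)) 1 × ClosedUnitBall n =>
      ((p.1 : EuclideanSpace ℝ (Fin n)), (p.2 : EuclideanSpace ℝ (Fin n)))) (𝓝 (x, y))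
      (𝓝 ((x : EuclideanSpace ℝ (Fin n)), (y : EuclideanSpace ℝ (Fin n)))) :=
    Continuous.tendsto (by fun_prop) (x, y)
  have h3 := h.tendsto.comp h2
  exact h3

lemma continuous_moebius {x : EuclideanSpace ℝ (Fin n)} (hx : ‖x‖ < 1) :
    Continuous (fun y : ClosedUnitBall n => moebius x (y : EuclideanSpace ℝ (Fin n))) := by
  rw [continuous_iff_continuousAt]
  intro y
  have h := continuousAt_moebius hx (mem_closedBall_zero_iff.1 y.2)
  have h2 : Tendsto (fun p : ClosedUnitBall n => (x, (p : EuclideanSpace ℝ (Fin n)))) (𝓝 y)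
      (𝓝 (x, (y : EuclideanSpace ℝ (Fin n)))) :=
    Continuous.tendsto (by fun_prop) y
  have h3 := h.tendsto.comp h2
  exact h3

/-! ### The radial field -/

lemma radialField_zero (g : ℝ → ℝ) :
    radialField g (0 : EuclideanSpace ℝ (Fin n)) = 0 := by simp [radialField]

/-- Division by zero being zero, the quotient formula also covers the origin, so no case split is
needed later. -/
lemma radialField_eq {g : ℝ → ℝ} {y : EuclideanSpace ℝ (Fin n)} :
    radialField g y = (g ‖y‖ / ‖y‖) • y := by
  by_cases h : y = 0
  · simp [h, radialField]
  · simp [h, radialField, smul_smul, div_eq_mul_inv]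

lemma norm_radialField_le (g : ℝ → ℝ) (y : EuclideanSpace ℝ (Fin n)) :
    ‖radialField g y‖ ≤ |g ‖y‖| := by
  by_cases h : y = 0
  · simp [h, radialField]
  · have : ‖y‖ ≠ 0 := norm_ne_zero_iff.2 h
    rw [radialField_eq, norm_smul, norm_div, norm_norm, div_mul_cancel₀ _ this, Real.norm_eq_abs]

lemma continuous_radialField {g : ℝ → ℝ} (hg : Continuous g) (hg0 : g 0 = 0) :
    Continuous (radialField g : EuclideanSpace ℝ (Fin n) → EuclideanSpace ℝ (Fin n)) := by
  rw [continuous_iff_continuousAt]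
  intro y
  by_cases h : y = 0
  · subst h
    rw [ContinuousAt, radialField_zero]
    refine squeeze_zero_norm (norm_radialField_le g) ?_
    have : Continuous fun z : EuclideanSpace ℝ (Fin n) => |g ‖z‖| := by fun_prop
    simpa [hg0] using this.tendsto 0
  · have e : (radialField g : EuclideanSpace ℝ (Fin n) → EuclideanSpace ℝ (Fin n)) =
      fun y => (g ‖y‖ / ‖y‖) • y := funext fun y => radialField_eq
    rw [e]
    have : ‖y‖ ≠ 0 := norm_ne_zero_iff.2 h
    refine ContinuousAt.smul (ContinuousAt.div ?_ ?_ this) ?_ <;> fun_prop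

lemma continuous_radialField_moebius {g : ℝ → ℝ} (hg : Continuous g) (hg0 : g 0 = 0)
    {x : EuclideanSpace ℝ (Fin n)} (hx : ‖x‖ < 1) :
    Continuous (fun y : ClosedUnitBall n => radialField g (moebius x y)) :=
  (continuous_radialField hg hg0).comp (continuous_moebius hx)

lemma integrable_of_continuous {F : Type*} [NormedAddCommGroup F] [SecondCountableTopology F]
    (μ : FiniteMeasure (ClosedUnitBall n)) {f : ClosedUnitBall n → F} (hf : Continuous f) :
    Integrable f (μ : Measure (ClosedUnitBall n)) :=
  hf.integrable_of_hasCompactSupport (HasCompactSupport.of_compactSpace f)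

/-! ### Hyperbolic triangles and the monotonicity inequality -/

/-- The hyperbolic sine law, deduced from the cosine law. -/
lemma sine_law {t₁ t₂ s P Q l : ℝ}
    (ha : 1 - 2 * P + t₁ ^ 2 * s ^ 2 = l * (1 - s ^ 2))
    (hb : l * (1 - 2 * Q + t₂ ^ 2 * s ^ 2) = 1 - s ^ 2)
    (hl : l * (1 - t₂ ^ 2) = 1 - t₁ ^ 2) :
    l ^ 2 * (t₂ ^ 2 * s ^ 2 - Q ^ 2) = t₁ ^ 2 * s ^ 2 - P ^ 2 := by
  have hQl : 2 * (Q * l) = l * (1 + s ^ 2) - 1 + t₁ ^ 2 * s ^ 2 := by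
    linear_combination -hb - s ^ 2 * hl
  have hP' : P = (1 + t₁ ^ 2 * s ^ 2 - l * (1 - s ^ 2)) / 2 := by linarith
  have e : (Q * l) ^ 2 = ((l * (1 + s ^ 2) - 1 + t₁ ^ 2 * s ^ 2) / 2) ^ 2 := by
    congr 1; linarith
  rw [hP']
  linear_combination -e - l * s ^ 2 * hl

/-- In a hyperbolic triangle with an obtuse angle, the opposite side is the longer one and the
cosines of the two angles at the base have nonnegative sum. -/
lemma obtuse_triangle {t₁ t₂ s P Q l : ℝ} (ht₁ : 0 ≤ t₁) (ht₂ : 0 ≤ t₂)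
    (hs : 0 < s) (hs1 : s < 1) (hP : P ^ 2 ≤ t₁ ^ 2 * s ^ 2) (ht₁' : t₁ ≤ 1)
    (ha : 1 - 2 * P + t₁ ^ 2 * s ^ 2 = l * (1 - s ^ 2))
    (hb : l * (1 - 2 * Q + t₂ ^ 2 * s ^ 2) = 1 - s ^ 2)
    (hl : l * (1 - t₂ ^ 2) = 1 - t₁ ^ 2) (hP0 : P < 0) :
    0 < t₁ ∧ 0 < Q ∧ t₁ ≤ t₂ ∧ (t₁ < 1 → t₁ < t₂) ∧ 0 ≤ P * t₂ + Q * t₁ ∧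
      (P ^ 2 < t₁ ^ 2 * s ^ 2 → 0 < P * t₂ + Q * t₁) := by
  have hs2 : 0 < 1 - s ^ 2 := by nlinarith
  -- An obtuse angle makes the left side of `ha` larger than 1, while `1 - s² < 1`.
  have h1 : 1 < l := by
    by_contra! h
    have : l * (1 - s ^ 2) ≤ 1 * (1 - s ^ 2) := by gcongr
    nlinarith [mul_nonneg (sq_nonneg t₁) (sq_nonneg s)]
  have ht0 : 0 < t₁ := by
    rcases ht₁.lt_or_eq with h | h
    · exact h
    · rw [← h] at hP; nlinarith
  have hQ : 0 < Q := by
    by_contra! h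
    have h2 : 1 ≤ 1 - 2 * Q + t₂ ^ 2 * s ^ 2 := by nlinarith [mul_nonneg (sq_nonneg t₂) (sq_nonneg s)]
    nlinarith
  have hsq : t₂ ^ 2 = 1 - (1 - t₁ ^ 2) / l := by
    rw [← hl]; field_simp; ring
  have hle : t₁ ^ 2 ≤ t₂ ^ 2 := by
    have : (1 - t₁ ^ 2) / l ≤ 1 - t₁ ^ 2 := div_le_self (by nlinarith) h1.le
    linarith
  have hle' : t₁ ≤ t₂ := by
    exact (pow_le_pow_iff_left₀ ht₁ ht₂ two_ne_zero).1 hle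
  have hsine := sine_law ha hb hl
  -- With P = t₁ s cos α and Q = t₂ s cos β this compares cos² β with cos² α. The last factor is
  -- positive because `l > 1` and `t₂ ≥ t₁ > 0`.
  have hkey : l ^ 2 * (Q ^ 2 * t₁ ^ 2 - P ^ 2 * t₂ ^ 2) =
      (t₁ ^ 2 * s ^ 2 - P ^ 2) * (l ^ 2 * t₂ ^ 2 - t₁ ^ 2) := by
    linear_combination -t₁ ^ 2 * hsine
  have hpos : 0 < l ^ 2 * t₂ ^ 2 - t₁ ^ 2 := by nlinarith [sq_pos_of_pos ht0]
  have hl2 : 0 < l ^ 2 := by positivity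
  refine ⟨ht0, hQ, hle', fun h => ?_, ?_, fun h => ?_⟩
  · have h2 : (1 - t₁ ^ 2) / l < 1 - t₁ ^ 2 := div_lt_self (by nlinarith) h1
    exact lt_of_pow_lt_pow_left₀ 2 ht₂ (by linarith)
  · have : 0 ≤ Q ^ 2 * t₁ ^ 2 - P ^ 2 * t₂ ^ 2 :=
      nonneg_of_mul_nonneg_right (hkey ▸ mul_nonneg (sub_nonneg.2 hP) hpos.le) hl2
    have : -P * t₂ ≤ Q * t₁ :=
      le_of_sq_le_sq (by nlinarith) (by positivity)
    linarith
  · have : 0 < Q ^ 2 * t₁ ^ 2 - P ^ 2 * t₂ ^ 2 :=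
      pos_of_mul_pos_right (hkey ▸ mul_pos (sub_pos.2 h) hpos) hl2.le
    have : -P * t₂ < Q * t₁ :=
      lt_of_pow_lt_pow_left₀ 2 (by positivity) (by nlinarith)
    linarith

/-- Split g(t₁) cos α + g(t₂) cos β as g(t₁)(cos α + cos β) + (g(t₂) - g(t₁)) cos β: both terms are
nonnegative, and either one can supply strictness. -/
lemma weighted_cos_sum_of_obtuse {g : ℝ → ℝ} {t₁ t₂ P Q : ℝ} (ht₁ : 0 < t₁) (ht₂ : t₁ ≤ t₂)
    (hQ : 0 < Q) (h0 : 0 ≤ P * t₂ + Q * t₁) (hg0 : 0 ≤ g t₁) (hg : g t₁ ≤ g t₂) :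
    0 ≤ g t₁ / t₁ * P + g t₂ / t₂ * Q ∧
      (0 < g t₁ ∧ 0 < P * t₂ + Q * t₁ ∨ g t₁ < g t₂ →
        0 < g t₁ / t₁ * P + g t₂ / t₂ * Q) := by
  have h2 : 0 < t₂ := ht₁.trans_le ht₂
  have e : g t₁ / t₁ * P + g t₂ / t₂ * Q =
      (g t₁ * (P * t₂ + Q * t₁) + (g t₂ - g t₁) * (Q * t₁)) / (t₁ * t₂) := by
    field_simp; ring
  rw [e]
  have h3 : 0 < Q * t₁ := mul_pos hQ ht₁
  have h4 := sub_nonneg.2 hg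
  refine ⟨by positivity, ?_⟩
  rintro (⟨h5, h6⟩ | h5)
  · positivity
  · have := sub_pos.2 h5
    positivity

/-- The monotonicity inequality in a hyperbolic triangle, in terms of the (pseudo)hyperbolic
side lengths `t₁, t₂, s` and the quantities `P = t₁ s cos α`, `Q = t₂ s cos β`. -/
lemma weighted_cos_sum {g : ℝ → ℝ} (hmono : MonotoneOn g (Set.Icc 0 1)) (hg0 : g 0 = 0)
    {t₁ t₂ s P Q l : ℝ} (ht₁ : 0 ≤ t₁) (ht₂ : 0 ≤ t₂) (ht₁' : t₁ ≤ 1) (ht₂' : t₂ ≤ 1)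
    (hs : 0 < s) (hs1 : s < 1) (hP : P ^ 2 ≤ t₁ ^ 2 * s ^ 2) (hQ : Q ^ 2 ≤ t₂ ^ 2 * s ^ 2)
    (hl0 : 0 < l) (ha : 1 - 2 * P + t₁ ^ 2 * s ^ 2 = l * (1 - s ^ 2))
    (hb : l * (1 - 2 * Q + t₂ ^ 2 * s ^ 2) = 1 - s ^ 2)
    (hl : l * (1 - t₂ ^ 2) = 1 - t₁ ^ 2) :
    0 ≤ g t₁ / t₁ * P + g t₂ / t₂ * Q ∧
      ((∀ r ∈ Set.Ioc (0 : ℝ) 1, 0 < g r) →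
        (P ^ 2 < t₁ ^ 2 * s ^ 2 ∧ Q ^ 2 < t₂ ^ 2 * s ^ 2 ∨ t₁ < 1 ∧ StrictMonoOn g (Set.Icc 0 1)) →
        0 < g t₁ / t₁ * P + g t₂ / t₂ * Q) := by
  have gnn : ∀ t, 0 ≤ t → t ≤ 1 → 0 ≤ g t := fun t h h' =>
    hg0 ▸ hmono (by simp) ⟨h, h'⟩ h
  have ha' : l⁻¹ * (1 - 2 * P + t₁ ^ 2 * s ^ 2) = 1 - s ^ 2 := by rw [ha]; field_simp
  have hb' : 1 - 2 * Q + t₂ ^ 2 * s ^ 2 = l⁻¹ * (1 - s ^ 2) := by rw [← hb]; field_simp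
  have hl' : l⁻¹ * (1 - t₁ ^ 2) = 1 - t₂ ^ 2 := by rw [← hl]; field_simp
  have hs2 : 0 < 1 - s ^ 2 := by nlinarith
  have hlt : t₁ < 1 → t₂ < 1 := fun h => by
    have : 0 < 1 - t₁ ^ 2 := by nlinarith
    have : 0 < 1 - t₂ ^ 2 := by rw [← hl']; positivity
    nlinarith
  rcases lt_or_ge P 0 with hP0 | hP0
  · obtain ⟨h1, h2, h3, h4, h5, h6⟩ := obtuse_triangle ht₁ ht₂ hs hs1 hP ht₁' ha hb hl hP0
    obtain ⟨h7, h8⟩ := weighted_cos_sum_of_obtuse h1 h3 h2 h5 (gnn _ ht₁ ht₁')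
      (hmono ⟨ht₁, ht₁'⟩ ⟨ht₂, ht₂'⟩ h3)
    refine ⟨h7, fun hpos h => h8 ?_⟩
    rcases h with ⟨h, _⟩ | ⟨h, hstr⟩
    · exact Or.inl ⟨hpos _ ⟨h1, ht₁'⟩, h6 h⟩
    · exact Or.inr (hstr ⟨ht₁, ht₁'⟩ ⟨ht₂, ht₂'⟩ (h4 h))
  rcases lt_or_ge Q 0 with hQ0 | hQ0
  · obtain ⟨h1, h2, h3, h4, h5, h6⟩ := obtuse_triangle ht₂ ht₁ hs hs1 hQ ht₂' hb' ha' hl' hQ0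
    obtain ⟨h7, h8⟩ := weighted_cos_sum_of_obtuse h1 h3 h2 h5 (gnn _ ht₂ ht₂')
      (hmono ⟨ht₂, ht₂'⟩ ⟨ht₁, ht₁'⟩ h3)
    rw [add_comm]
    refine ⟨h7, fun hpos h => h8 ?_⟩
    rcases h with ⟨_, h⟩ | ⟨h, hstr⟩
    · exact Or.inl ⟨hpos _ ⟨h1, ht₂'⟩, h6 h⟩
    · exact Or.inr (hstr ⟨ht₂, ht₂'⟩ ⟨ht₁, ht₁'⟩ (h4 (hlt h)))
  have g1 := gnn _ ht₁ ht₁'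
  have g2 := gnn _ ht₂ ht₂'
  refine ⟨by positivity, fun hpos _ => ?_⟩
  rcases hP0.lt_or_eq with hP1 | hP1
  · have ht : 0 < t₁ := by
      rcases ht₁.lt_or_eq with h | h
      · exact h
      · rw [← h] at hP; nlinarith
    have := hpos _ ⟨ht, ht₁'⟩
    positivity
  -- Two right angles at the base are impossible: `P = 0` forces `l > 1` and `Q = 0` forces `l < 1`.
  · have hQ1 : 0 < Q := by
      rcases hQ0.lt_or_eq with h | h
      · exact h
      · rw [← hP1] at ha
        rw [← h] at hb
        have h1 : 1 < l := by
          by_contra! h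
          have : l * (1 - s ^ 2) ≤ 1 * (1 - s ^ 2) := by gcongr
          nlinarith [mul_nonneg (sq_nonneg t₁) (sq_nonneg s)]
        nlinarith [mul_nonneg (sq_nonneg t₂) (sq_nonneg s)]
    have ht : 0 < t₂ := by
      rcases ht₂.lt_or_eq with h | h
      · exact h
      · rw [← h] at hQ; nlinarith
    have := hpos _ ⟨ht, ht₂'⟩
    positivity

/-! ### Positivity of the pairing -/

/-- Sum of the components at `x₁`, `x₂` of the field `v(T_x(y))` along the geodesic
joining the two base points. -/
noncomputable def pairing (g : ℝ → ℝ) (x₁ x₂ y : EuclideanSpace ℝ (Fin n)) : ℝ :=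
  inner ℝ (moebius x₁ (-x₂)) (radialField g (moebius x₁ y)) +
    inner ℝ (moebius x₂ (-x₁)) (radialField g (moebius x₂ y))

lemma moebius_zero (x : EuclideanSpace ℝ (Fin n)) : moebius x 0 = x := by
  simp [moebius]

lemma moebius_neg_ne_zero {x₁ x₂ : EuclideanSpace ℝ (Fin n)} (h₁ : ‖x₁‖ < 1) (h₂ : ‖x₂‖ < 1)
    (hne : x₁ ≠ x₂) : moebius x₁ (-x₂) ≠ 0 := by
  intro h
  have := moebius_neg_moebius (y := -x₂) h₁ (by rw [norm_neg]; exact h₂.le)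
  rw [h, moebius_zero] at this
  exact hne (neg_injective this)

lemma norm_moebius_neg_comm {x₁ x₂ : EuclideanSpace ℝ (Fin n)} (h₁ : ‖x₁‖ < 1) (h₂ : ‖x₂‖ < 1) :
    ‖moebius x₁ (-x₂)‖ = ‖moebius x₂ (-x₁)‖ := by
  have e1 := one_sub_norm_moebius_sq (y := -x₂) h₁ (by rw [norm_neg]; exact h₂.le)
  have e2 := one_sub_norm_moebius_sq (y := -x₁) h₂ (by rw [norm_neg]; exact h₁.le)
  rw [den_neg_comm x₂ x₁, norm_neg] at e2
  rw [norm_neg] at e1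
  have : ‖moebius x₁ (-x₂)‖ ^ 2 = ‖moebius x₂ (-x₁)‖ ^ 2 := by
    have : 1 - ‖moebius x₁ (-x₂)‖ ^ 2 = 1 - ‖moebius x₂ (-x₁)‖ ^ 2 := by rw [e1, e2]; ring
    linarith
  exact (pow_left_inj₀ (norm_nonneg _) (norm_nonneg _) two_ne_zero).1 this

lemma inner_sq_le (a b : EuclideanSpace ℝ (Fin n)) : (inner ℝ a b) ^ 2 ≤ ‖a‖ ^ 2 * ‖b‖ ^ 2 := by
  rw [← mul_pow, ← sq_abs]
  exact pow_le_pow_left₀ (abs_nonneg _) (abs_real_inner_le_norm a b) 2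

/-- This is `weighted_cos_sum` for the triangle with vertices `-x₁`, `-x₂`, `y`. Strictness needs
either a nondegenerate triangle or an interior `y` together with strict monotonicity. -/
lemma pairing_spec {g : ℝ → ℝ} (hmono : MonotoneOn g (Set.Icc 0 1)) (hg0 : g 0 = 0)
    {x₁ x₂ y : EuclideanSpace ℝ (Fin n)} (h₁ : ‖x₁‖ < 1) (h₂ : ‖x₂‖ < 1) (hne : x₁ ≠ x₂)
    (hy : ‖y‖ ≤ 1) :
    0 ≤ pairing g x₁ x₂ y ∧ ((∀ r ∈ Set.Ioc (0 : ℝ) 1, 0 < g r) →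
      ((inner ℝ (moebius x₁ y) (moebius x₁ (-x₂))) ^ 2 <
        ‖moebius x₁ y‖ ^ 2 * ‖moebius x₁ (-x₂)‖ ^ 2 ∨
        ‖moebius x₁ y‖ < 1 ∧ StrictMonoOn g (Set.Icc 0 1)) → 0 < pairing g x₁ x₂ y) := by
  have h₁' : ‖-x₁‖ < 1 := by rwa [norm_neg]
  have h₂' : ‖-x₂‖ < 1 := by rwa [norm_neg]
  have hS := norm_moebius_neg_comm h₁ h₂
  have e : pairing g x₁ x₂ y =
      g ‖moebius x₁ y‖ / ‖moebius x₁ y‖ * inner ℝ (moebius x₁ y) (moebius x₁ (-x₂)) +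
      g ‖moebius x₂ y‖ / ‖moebius x₂ y‖ * inner ℝ (moebius x₂ y) (moebius x₂ (-x₁)) := by
    simp only [pairing, radialField_eq, inner_smul_right, real_inner_comm]
  have f1 := one_sub_two_inner_moebius h₁ hy h₂'.le
  have f2 := one_sub_two_inner_moebius h₂ hy h₁'.le
  have f3 := one_sub_norm_moebius_sq h₁ hy
  have f4 := one_sub_norm_moebius_sq h₂ hy
  have f5 := one_sub_norm_moebius_sq h₁ h₂'.le
  rw [neg_neg] at f1 f2
  rw [den_neg_comm x₂ x₁] at f2
  rw [norm_neg] at f5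
  have d1 := den_pos h₁ hy
  have d2 := den_pos h₂ hy
  have d3 := den_pos h₁ h₂'.le
  have q1 := one_sub_norm_sq_pos h₁
  have q2 := one_sub_norm_sq_pos h₂
  have hP := inner_sq_le (moebius x₁ y) (moebius x₁ (-x₂))
  have hQ := inner_sq_le (moebius x₂ y) (moebius x₂ (-x₁))
  have t1 := norm_moebius_le_one h₁ hy
  have t2 := norm_moebius_le_one h₂ hy
  have hs : 0 < ‖moebius x₁ (-x₂)‖ := norm_pos_iff.2 (moebius_neg_ne_zero h₁ h₂ hne)
  have hs1 : ‖moebius x₁ (-x₂)‖ < 1 := norm_moebius_lt_one h₁ h₂'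
  rw [← hS] at hQ f2
  rw [e]
  -- This is the ratio of `1 - t₁²` to `1 - t₂²` with the factor `1 - ‖y‖²` cancelled, so it remains
  -- meaningful for `y` on the sphere.
  have hl0 : 0 < (1 - ‖x₁‖ ^ 2) * den x₂ y / ((1 - ‖x₂‖ ^ 2) * den x₁ y) := by positivity
  have ha : 1 - 2 * inner ℝ (moebius x₁ y) (moebius x₁ (-x₂)) +
      ‖moebius x₁ y‖ ^ 2 * ‖moebius x₁ (-x₂)‖ ^ 2 =
      (1 - ‖x₁‖ ^ 2) * den x₂ y / ((1 - ‖x₂‖ ^ 2) * den x₁ y) *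
        (1 - ‖moebius x₁ (-x₂)‖ ^ 2) := by
    rw [f1, f5]; field_simp
  have hb : (1 - ‖x₁‖ ^ 2) * den x₂ y / ((1 - ‖x₂‖ ^ 2) * den x₁ y) *
      (1 - 2 * inner ℝ (moebius x₂ y) (moebius x₂ (-x₁)) +
      ‖moebius x₂ y‖ ^ 2 * ‖moebius x₁ (-x₂)‖ ^ 2) = 1 - ‖moebius x₁ (-x₂)‖ ^ 2 := by
    rw [f2, f5]; field_simp
  have hl : (1 - ‖x₁‖ ^ 2) * den x₂ y / ((1 - ‖x₂‖ ^ 2) * den x₁ y) *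
      (1 - ‖moebius x₂ y‖ ^ 2) = 1 - ‖moebius x₁ y‖ ^ 2 := by
    rw [f3, f4]; field_simp
  obtain ⟨k1, k2⟩ := weighted_cos_sum hmono hg0 (norm_nonneg _) (norm_nonneg _) t1 t2 hs hs1
    hP hQ hl0 ha hb hl
  refine ⟨k1, fun hpos h => k2 hpos ?_⟩
  rcases h with h | h
  · refine Or.inl ⟨h, ?_⟩
    -- The sine law carries non-collinearity from the vertex `-x₁` to the vertex `-x₂`.
    have hsine := sine_law ha hb hl
    rw [← sub_pos, ← hsine] at h
    exact sub_pos.1 (pos_of_mul_pos_right h (sq_nonneg _))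
  · exact Or.inr h

/-! ### Geodesics as Möbius images of diameters -/

lemma eq_smul_of_inner_sq_eq {a b : EuclideanSpace ℝ (Fin n)} (hb : b ≠ 0)
    (h : ‖a‖ ^ 2 * ‖b‖ ^ 2 ≤ (inner ℝ a b) ^ 2) : a = (inner ℝ a b / ‖b‖ ^ 2) • b := by
  have hb' : 0 < ‖b‖ ^ 2 := by have := norm_pos_iff.2 hb; positivity
  have : ‖a - (inner ℝ a b / ‖b‖ ^ 2) • b‖ ^ 2 ≤ 0 := by
    rw [norm_sub_sq_real, inner_smul_right, norm_smul, mul_pow, Real.norm_eq_abs, sq_abs]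
    have e : ‖a‖ ^ 2 - 2 * (inner ℝ a b / ‖b‖ ^ 2 * inner ℝ a b) +
        (inner ℝ a b / ‖b‖ ^ 2) ^ 2 * ‖b‖ ^ 2 =
        (‖a‖ ^ 2 * ‖b‖ ^ 2 - inner ℝ a b ^ 2) / ‖b‖ ^ 2 := by
      field_simp; ring
    rw [e]
    exact div_nonpos_of_nonpos_of_nonneg (by linarith) hb'.le
  rw [sq_nonpos_iff, norm_eq_zero, sub_eq_zero] at this
  exact this

/-- The centre of the orthogonal circle carrying the geodesic through `x` with
direction `e` at `x`. -/
lemma exists_orthogonal_circle {x e : EuclideanSpace ℝ (Fin n)} (hx : ‖x‖ < 1)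
    (he : ‖e‖ = 1) (hne : (inner ℝ x e) ^ 2 < ‖x‖ ^ 2) :
    ∃ c ∈ Submodule.span ℝ {x, e}, 1 < ‖c‖ ^ 2 ∧
      ∀ r : ℝ, |r| ≤ 1 → ‖moebius x (r • e)‖ ^ 2 + 1 = 2 * inner ℝ (moebius x (r • e)) c := by
  set k := inner ℝ x e with hk
  have hd : 0 < ‖x‖ ^ 2 - k ^ 2 := sub_pos.2 hne
  -- The circle orthogonal to the unit sphere with center `c` is ‖p‖² + 1 = 2⟨p, c⟩. Passing through
  -- `x` requires ⟨x, c⟩ = (1 + ‖x‖²)/2, and tangency to `e` at `x` requires ⟨e, c⟩ = ⟨x, e⟩; `β`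
  -- solves both equations.
  set β := ((1 + ‖x‖ ^ 2) / 2 - k ^ 2) / (‖x‖ ^ 2 - k ^ 2) with hβ
  have hβ' : β * (‖x‖ ^ 2 - k ^ 2) = (1 + ‖x‖ ^ 2) / 2 - k ^ 2 := by rw [hβ]; field_simp
  set c := β • x + (k - β * k) • e with hc
  have hxc : inner ℝ x c = (1 + ‖x‖ ^ 2) / 2 := by
    rw [hc, inner_add_right, inner_smul_right, inner_smul_right, real_inner_self_eq_norm_sq, ← hk]
    linear_combination hβ'
  have hec : inner ℝ e c = k := by
    rw [hc, inner_add_right, inner_smul_right, inner_smul_right, real_inner_self_eq_norm_sq,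
      real_inner_comm, ← hk, he]
    ring
  refine ⟨c, ?_, ?_, fun r hr => ?_⟩
  · exact add_mem (Submodule.smul_mem _ _ (Submodule.subset_span (by simp)))
      (Submodule.smul_mem _ _ (Submodule.subset_span (by simp)))
  · have h1 := real_inner_le_norm x c
    rw [hxc] at h1
    have hx0 : 0 < ‖x‖ := by
      rcases (norm_nonneg x).lt_or_eq with h | h
      · exact h
      · rw [← h] at hne; nlinarith
    have h2 : 1 < ‖c‖ := by
      by_contra! h
      nlinarith
    nlinarith
  · have hre : ‖r • e‖ = |r| := by rw [norm_smul, he, mul_one, Real.norm_eq_abs]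
    have hre1 : ‖r • e‖ ≤ 1 := hre ▸ hr
    have h := one_sub_norm_moebius_sq hx hre1
    have hd := den_pos hx hre1
    have e1 : ‖moebius x (r • e)‖ ^ 2 + 1 =
      2 - (1 - ‖x‖ ^ 2) * (1 - ‖r • e‖ ^ 2) / den x (r • e) := by rw [← h]; ring
    rw [e1, moebius_eq, inner_smul_left, inner_add_left, inner_smul_left, inner_smul_left,
      inner_smul_left e, hxc, hec]
    simp only [RCLike.conj_to_real]
    field_simp
    rw [den, hre, sq_abs, inner_smul_right, ← hk]
    ring

lemma finrank_span_pair_eq_two {x e : EuclideanSpace ℝ (Fin n)}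
    (he : ‖e‖ = 1) (hne : (inner ℝ x e) ^ 2 < ‖x‖ ^ 2) :
    Module.finrank ℝ (Submodule.span ℝ {x, e}) = 2 := by
  have he0 : e ≠ 0 := by rintro rfl; simp at he
  have hli : LinearIndependent ℝ ![e, x] := by
    rw [LinearIndependent.pair_iff' he0]
    rintro a rfl
    rw [inner_smul_left, real_inner_self_eq_norm_sq, norm_smul, he] at hne
    simp at hne
  have := finrank_span_eq_card hli
  rw [Matrix.range_cons_cons_empty, Set.pair_comm] at this
  simpa using this

/-- A Möbius transformation maps a closed diameter into the closure of a geodesic. -/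
lemma exists_geodesic_moebius_diameter {x e : EuclideanSpace ℝ (Fin n)} (hx : ‖x‖ < 1)
    (he : ‖e‖ = 1) :
    ∃ γ, IsHypGeodesic γ ∧ ∀ r : ℝ, |r| ≤ 1 → moebius x (r • e) ∈ closure γ := by
  have hre : ∀ r : ℝ, ‖r • e‖ = |r| := fun r => by rw [norm_smul, he, mul_one, Real.norm_eq_abs]
  have he0 : e ≠ 0 := by rintro rfl; simp at he
  -- It suffices to treat |r| < 1: the endpoints are limits of `T_x((t r) e)` as `t` increases to 1.
  have key : ∀ γ : Set (EuclideanSpace ℝ (Fin n)),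
      (∀ r : ℝ, |r| < 1 → moebius x (r • e) ∈ γ) →
      ∀ r : ℝ, |r| ≤ 1 → moebius x (r • e) ∈ closure γ := by
    intro γ hγ r hr
    have h1 := continuousAt_moebius hx ((hre r).trans_le hr)
    have h2 : Tendsto (fun t : ℝ => (x, (t * r) • e)) (𝓝[<] 1) (𝓝 (x, r • e)) := by
      have : Continuous (fun t : ℝ => (x, (t * r) • e)) := by fun_prop
      have h3 := this.tendsto 1
      rw [one_mul] at h3
      exact h3.mono_left nhdsWithin_le_nhds
    refine mem_closure_of_tendsto (h1.tendsto.comp h2) ?_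
    have h4 : Set.Ioo (0 : ℝ) 1 ∈ 𝓝[<] (1 : ℝ) := Ioo_mem_nhdsLT zero_lt_one
    filter_upwards [h4] with t ht
    refine hγ _ ?_
    rw [abs_mul, abs_of_pos ht.1]
    exact (mul_le_of_le_one_right ht.1.le hr).trans_lt ht.2
  have hball : ∀ r : ℝ, |r| < 1 → moebius x (r • e) ∈ Metric.ball (0 : EuclideanSpace ℝ (Fin n)) 1 :=
    fun r hr => mem_ball_zero_iff.2 (norm_moebius_lt_one hx (by rwa [hre]))
  rcases lt_or_ge ((inner ℝ x e) ^ 2) (‖x‖ ^ 2) with hne | hpar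
  · obtain ⟨c, hcP, hc1, hc⟩ := exists_orthogonal_circle hx he hne
    have hR : √(‖c‖ ^ 2 - 1) ^ 2 = ‖c‖ ^ 2 - 1 := Real.sq_sqrt (by linarith)
    refine ⟨_, Or.inr ⟨Submodule.span ℝ {x, e}, c, √(‖c‖ ^ 2 - 1),
      finrank_span_pair_eq_two he hne, hcP, Real.sqrt_pos.2 (by linarith), by linarith, rfl⟩,
      key _ fun r hr => ⟨⟨?_, ?_⟩, hball r hr⟩⟩
    · rw [moebius_eq]
      have hx' : x ∈ Submodule.span ℝ {x, e} := Submodule.subset_span (by simp)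
      have he' : e ∈ Submodule.span ℝ {x, e} := Submodule.subset_span (by simp)
      exact Submodule.smul_mem _ _ (add_mem (Submodule.smul_mem _ _ hx')
        (Submodule.smul_mem _ _ (Submodule.smul_mem _ _ he')))
    · rw [mem_sphere_iff_norm, ← pow_left_inj₀ (norm_nonneg _) (Real.sqrt_nonneg _) two_ne_zero,
        hR, norm_sub_sq_real, ← hc r hr.le]
      ring
  · have hxe : x = (inner ℝ x e / ‖e‖ ^ 2) • e := eq_smul_of_inner_sq_eq he0 (by simpa [he] using hpar)
    refine ⟨_, Or.inl ⟨Submodule.span ℝ {e}, finrank_span_singleton he0, rfl⟩,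
      key _ fun r hr => ⟨?_, hball r hr⟩⟩
    have he' : e ∈ Submodule.span ℝ {e} := Submodule.mem_span_singleton_self e
    have hx' : x ∈ Submodule.span ℝ {e} := by
      rw [hxe]; exact Submodule.smul_mem _ _ he'
    rw [moebius_eq]
    exact Submodule.smul_mem _ _ (add_mem (Submodule.smul_mem _ _ hx')
      (Submodule.smul_mem _ _ (Submodule.smul_mem _ _ he')))

/-! ### Uniqueness of the center -/

lemma continuous_pairing {g : ℝ → ℝ} (hg : Continuous g) (hg0 : g 0 = 0)
    {x₁ x₂ : EuclideanSpace ℝ (Fin n)} (h₁ : ‖x₁‖ < 1) (h₂ : ‖x₂‖ < 1) :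
    Continuous fun y : ClosedUnitBall n => pairing g x₁ x₂ y :=
  (continuous_const.inner (continuous_radialField_moebius hg hg0 h₁)).add
    (continuous_const.inner (continuous_radialField_moebius hg hg0 h₂))

lemma integral_pairing {g : ℝ → ℝ} (hg : Continuous g) (hg0 : g 0 = 0)
    {μ : FiniteMeasure (ClosedUnitBall n)} {x₁ x₂ : EuclideanSpace ℝ (Fin n)}
    (h₁ : IsCenter g μ x₁) (h₂ : IsCenter g μ x₂) :
    ∫ y : ClosedUnitBall n, pairing g x₁ x₂ y ∂(μ : Measure (ClosedUnitBall n)) = 0 := by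
  have b₁ := mem_ball_zero_iff.1 h₁.1
  have b₂ := mem_ball_zero_iff.1 h₂.1
  have i₁ := integrable_of_continuous μ (continuous_radialField_moebius hg hg0 b₁)
  have i₂ := integrable_of_continuous μ (continuous_radialField_moebius hg hg0 b₂)
  have e₁ := integral_inner (𝕜 := ℝ) i₁ (moebius x₁ (-x₂))
  have e₂ := integral_inner (𝕜 := ℝ) i₂ (moebius x₂ (-x₁))
  have z₁ := h₁.2
  have z₂ := h₂.2
  unfold centerField at z₁ z₂
  rw [z₁, inner_zero_right] at e₁
  rw [z₂, inner_zero_right] at e₂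
  unfold pairing
  rw [integral_add (i₁.const_inner (𝕜 := ℝ) _) (i₂.const_inner (𝕜 := ℝ) _), e₁, e₂, add_zero]

lemma measure_univ_le_of_ae_pair {μ : FiniteMeasure (ClosedUnitBall n)} {a b : ClosedUnitBall n}
    (h : ∀ᵐ y ∂(μ : Measure (ClosedUnitBall n)), y = a ∨ y = b) :
    μ Set.univ ≤ μ {a} + μ {b} := by
  have h1 : (μ : Measure (ClosedUnitBall n)) Set.univ ≤
      (μ : Measure (ClosedUnitBall n)) {a} + (μ : Measure (ClosedUnitBall n)) {b} := by
    refine (measure_mono_ae ?_).trans (measure_union_le {a} {b})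
    filter_upwards [h] with y hy _
    exact hy
  simpa only [← FiniteMeasure.ennreal_coeFn_eq_coeFn_toMeasure, ← ENNReal.coe_add,
    ENNReal.coe_le_coe] using h1

lemma pos_of_condI {g : ℝ → ℝ} (hg0 : g 0 = 0) (h : CondI g) :
    ∀ r ∈ Set.Ioc (0 : ℝ) 1, 0 < g r := fun r hr =>
  hg0 ▸ h (by simp) ⟨hr.1.le, hr.2⟩ hr.1

lemma pos_of_condII {g : ℝ → ℝ} {μ : FiniteMeasure (ClosedUnitBall n)} (h : CondII g μ) :
    ∀ r ∈ Set.Ioc (0 : ℝ) 1, 0 < g r := fun r hr =>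
  -- Comparison with `r / 2` brings in the endpoint `r = 1`, where positivity is not assumed.
  (h.2.1 (r / 2) ⟨by linarith [hr.1], by linarith [hr.2]⟩).trans_le
    (h.1 ⟨by linarith [hr.1], by linarith [hr.2]⟩ ⟨hr.1.le, hr.2⟩ (by linarith [hr.1]))

/-- The nonnegative pairing has integral zero, so almost every `y` has `T_{x₁}(y)` on the line
spanned by `S`. Applying `T_{-x₁}` puts these `y` on one closed geodesic, and under (i) on its two
endpoints, whose atoms weigh less than the total mass. -/
theorem center_unique {g : ℝ → ℝ} (hg : Continuous g) (hg0 : g 0 = 0)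
    {μ : FiniteMeasure (ClosedUnitBall n)} (hμ : Admissible μ) (hc : CondI g ∨ CondII g μ)
    {x₁ x₂ : EuclideanSpace ℝ (Fin n)} (h₁ : IsCenter g μ x₁) (h₂ : IsCenter g μ x₂) :
    x₁ = x₂ := by
  by_contra hne
  have b₁ := mem_ball_zero_iff.1 h₁.1
  have b₂ := mem_ball_zero_iff.1 h₂.1
  have b₁' : ‖-x₁‖ < 1 := by rwa [norm_neg]
  have hmono : MonotoneOn g (Set.Icc 0 1) := hc.elim (fun h => h.monotoneOn) fun h => h.1
  have hpos : ∀ r ∈ Set.Ioc (0 : ℝ) 1, 0 < g r := hc.elim (pos_of_condI hg0) pos_of_condII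
  have hball : ∀ y : ClosedUnitBall n, ‖(y : EuclideanSpace ℝ (Fin n))‖ ≤ 1 :=
    fun y => mem_closedBall_zero_iff.1 y.2
  have hspec := fun y : ClosedUnitBall n => pairing_spec hmono hg0 b₁ b₂ hne (hball y)
  have hae := (integral_eq_zero_iff_of_nonneg (fun y => (hspec y).1)
    (integrable_of_continuous μ (continuous_pairing hg hg0 b₁ b₂))).1 (integral_pairing hg hg0 h₁ h₂)
  have hS0 := moebius_neg_ne_zero b₁ b₂ hne
  set S := moebius x₁ (-x₂) with hS
  have hs : 0 < ‖S‖ := norm_pos_iff.2 hS0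
  set e := ‖S‖⁻¹ • S with he
  have he1 : ‖e‖ = 1 := by rw [he, norm_smul, norm_inv, norm_norm, inv_mul_cancel₀ hs.ne']
  have hline : ∀ y : ClosedUnitBall n, pairing g x₁ x₂ y = 0 →
      ∃ r : ℝ, |r| = ‖moebius x₁ y‖ ∧ (y : EuclideanSpace ℝ (Fin n)) = moebius (-x₁) (r • e) := by
    intro y hy
    have h : ¬ (inner ℝ (moebius x₁ y) S) ^ 2 < ‖moebius x₁ y‖ ^ 2 * ‖S‖ ^ 2 :=
      fun h => ((hspec y).2 hpos (Or.inl h)).ne' hy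
    have h1 := eq_smul_of_inner_sq_eq hS0 (not_lt.1 h)
    have h2 : moebius x₁ y = (inner ℝ (moebius x₁ y) S / ‖S‖) • e := by
      rw [he, smul_smul]
      convert h1 using 2
      field_simp
    refine ⟨inner ℝ (moebius x₁ y) S / ‖S‖, ?_, ?_⟩
    · conv_rhs => rw [h2, norm_smul, he1, mul_one, Real.norm_eq_abs]
    · rw [← h2, moebius_neg_moebius b₁ (hball y)]
  rcases hc with hc | hc
  · have hend : ∀ c : EuclideanSpace ℝ (Fin n), ‖c‖ = 1 → ‖moebius (-x₁) c‖ = 1 :=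
      fun c h => norm_moebius_eq_one b₁' h
    have hne1 : ‖-e‖ = 1 := by rwa [norm_neg]
    let a : ClosedUnitBall n :=
      ⟨moebius (-x₁) e, mem_closedBall_zero_iff.2 (hend e he1).le⟩
    let b : ClosedUnitBall n :=
      ⟨moebius (-x₁) (-e), mem_closedBall_zero_iff.2 (hend (-e) hne1).le⟩
    have h3 : μ Set.univ ≤ μ {a} + μ {b} := by
      refine measure_univ_le_of_ae_pair ?_
      filter_upwards [hae] with y hy
      obtain ⟨r, hr, hyr⟩ := hline y hy
      have h4 : ‖moebius x₁ y‖ = 1 :=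
        (norm_moebius_le_one b₁ (hball y)).antisymm
          (not_lt.1 fun h => ((hspec y).2 hpos (Or.inr ⟨h, hc⟩)).ne' hy)
      rw [h4] at hr
      rcases eq_or_eq_neg_of_abs_eq hr with h | h
      · left; apply Subtype.ext; rw [hyr, h, one_smul]
      · right; apply Subtype.ext; rw [hyr, h, neg_smul, one_smul]
    have h5 := add_lt_add (hμ.2 a (hend e he1)) (hμ.2 b (hend (-e) hne1))
    rw [add_halves] at h5
    exact absurd h3 (not_le.2 h5)
  · obtain ⟨γ, hγ, hγe⟩ := exists_geodesic_moebius_diameter b₁' he1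
    have h3 := hc.2.2 γ hγ
    have h4 : (μ : Measure (ClosedUnitBall n))
        {y : ClosedUnitBall n | (y : EuclideanSpace ℝ (Fin n)) ∉ closure γ} = 0 := by
      rw [← compl_mem_ae_iff]
      filter_upwards [hae] with y hy
      obtain ⟨r, hr, hyr⟩ := hline y hy
      rw [Set.mem_compl_iff, Set.mem_ofPred_eq, not_not, hyr]
      exact hγe r (hr.trans_le (norm_moebius_le_one b₁ (hball y)))
    rw [← FiniteMeasure.ennreal_coeFn_eq_coeFn_toMeasure, ENNReal.coe_eq_zero] at h4
    exact h3.ne' h4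

/-! ### Behavior near the boundary -/

lemma norm_coe_le_one (y : ClosedUnitBall n) : ‖(y : EuclideanSpace ℝ (Fin n))‖ ≤ 1 :=
  mem_closedBall_zero_iff.1 y.2

lemma coe_measure_eq_real (μ : FiniteMeasure (ClosedUnitBall n)) (s : Set (ClosedUnitBall n)) :
    (μ s : ℝ) = (μ : Measure (ClosedUnitBall n)).real s := rfl

lemma Admissible.two_mul_real_lt {μ : FiniteMeasure (ClosedUnitBall n)} (hμ : Admissible μ)
    {p : ClosedUnitBall n} (hp : ‖(p : EuclideanSpace ℝ (Fin n))‖ = 1) :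
    2 * (μ : Measure (ClosedUnitBall n)).real {p} <
      (μ : Measure (ClosedUnitBall n)).real Set.univ := by
  have h := NNReal.coe_lt_coe.2 (hμ.2 p hp)
  rw [NNReal.coe_div, coe_measure_eq_real, coe_measure_eq_real, NNReal.coe_ofNat] at h
  linarith

lemma Admissible.real_univ_pos {μ : FiniteMeasure (ClosedUnitBall n)} (hμ : Admissible μ) :
    0 < (μ : Measure (ClosedUnitBall n)).real Set.univ :=
  NNReal.coe_pos.2 hμ.1

/-- A continuous cutoff function around a boundary point, carrying less than half of
the total mass. -/
lemma exists_cutoff {μ : FiniteMeasure (ClosedUnitBall n)} (hμ : Admissible μ)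
    {p : EuclideanSpace ℝ (Fin n)} (hp : ‖p‖ = 1) :
    ∃ η > 0, ∃ φ : ClosedUnitBall n → ℝ, Continuous φ ∧ (∀ y, 0 ≤ φ y) ∧
      (∀ y : ClosedUnitBall n, ‖(y : EuclideanSpace ℝ (Fin n)) - p‖ < η → φ y = 1) ∧
      2 * ∫ y, φ y ∂(μ : Measure (ClosedUnitBall n)) <
        (μ : Measure (ClosedUnitBall n)).real Set.univ := by
  -- `φ j` is 1 within distance 1/(j+1) of `p` and 0 beyond twice that, so its integral tends to the
  -- mass of the atom at `p`, which is less than half of the total.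
  let φ : ℕ → ClosedUnitBall n → ℝ := fun j y =>
    max 0 (min 1 (2 - (j + 1) * ‖(y : EuclideanSpace ℝ (Fin n)) - p‖))
  have hφc : ∀ j, Continuous (φ j) := fun j => by simp only [φ]; fun_prop
  have hφ0 : ∀ j y, 0 ≤ φ j y := fun j y => le_max_left _ _
  have hφ1 : ∀ j y, φ j y ≤ 1 := fun j y => max_le zero_le_one (min_le_left _ _)
  let p' : ClosedUnitBall n := ⟨p, mem_closedBall_zero_iff.2 hp.le⟩
  have hlim : Tendsto (fun j => ∫ y, φ j y ∂(μ : Measure (ClosedUnitBall n))) atTop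
      (𝓝 (∫ y, Set.indicator {p'} (fun _ => (1 : ℝ)) y ∂(μ : Measure (ClosedUnitBall n)))) := by
    refine tendsto_integral_of_dominated_convergence (fun _ => 1)
      (fun j => (hφc j).aestronglyMeasurable) (integrable_const _) (fun j => ?_) ?_
    · filter_upwards with y
      rw [Real.norm_of_nonneg (hφ0 j y)]
      exact hφ1 j y
    · filter_upwards with y
      by_cases hy : y = p'
      · rw [Set.indicator_of_mem (Set.mem_singleton_iff.2 hy)]
        refine tendsto_const_nhds.congr fun j => ?_
        simp [φ, hy, p']
      · rw [Set.indicator_of_notMem (by simpa using hy)]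
        have hpos : 0 < ‖(y : EuclideanSpace ℝ (Fin n)) - p‖ :=
          norm_pos_iff.2 (sub_ne_zero.2 fun h => hy (Subtype.ext h))
        obtain ⟨N, hN⟩ := exists_nat_gt (2 / ‖(y : EuclideanSpace ℝ (Fin n)) - p‖)
        refine tendsto_const_nhds.congr' ?_
        filter_upwards [eventually_ge_atTop N] with j hj
        rw [div_lt_iff₀ hpos] at hN
        have : (N : ℝ) ≤ j := by exact_mod_cast hj
        refine (max_eq_left ((min_le_right _ _).trans ?_)).symm
        nlinarith
  rw [integral_indicator_const _ (measurableSet_singleton p'), smul_eq_mul, mul_one] at hlim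
  have h2 := (hlim.const_mul 2).eventually (gt_mem_nhds (hμ.two_mul_real_lt (p := p') hp))
  obtain ⟨j, hj⟩ := h2.exists
  refine ⟨1 / ((j : ℝ) + 1), by positivity, φ j, hφc j, hφ0 j, fun y hy => ?_, hj⟩
  rw [lt_div_iff₀ (by positivity)] at hy
  have h3 : (1 : ℝ) ≤ 2 - (j + 1) * ‖(y : EuclideanSpace ℝ (Fin n)) - p‖ := by linarith
  simp only [φ]
  rw [min_eq_left h3, max_eq_right zero_le_one]

/-- Near a boundary point `z`, the transformations `T_x` push everything away from `-z` to `z`. -/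
lemma exists_moebius_near {z : EuclideanSpace ℝ (Fin n)} (hz : ‖z‖ = 1) {η ε : ℝ} (hη : 0 < η)
    (hε : 0 < ε) : ∃ δ > 0, ∀ x y : EuclideanSpace ℝ (Fin n), ‖x‖ < 1 → ‖y‖ ≤ 1 → ‖x - z‖ < δ →
      η ≤ ‖y - -z‖ → (η / 2) ^ 2 ≤ den x y ∧ ‖moebius x y - z‖ < ε := by
  -- The first bound keeps ‖x + y‖ ≥ η/2, hence `den` ≥ (η/2)². Then ‖T_x y - x‖ ≤ (16/η²)‖x - z‖,
  -- and adding ‖x - z‖ gives the second bound.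
  refine ⟨min (η / 2) (ε / (1 + 16 / η ^ 2)), by positivity, fun x y hx hy hxz hyz => ?_⟩
  have h1 := hxz.trans_le (min_le_left _ _)
  have h2 := hxz.trans_le (min_le_right _ _)
  rw [lt_div_iff₀ (by positivity)] at h2
  have h3 : η / 2 ≤ ‖x + y‖ := by
    have e : y - -z = (x + y) - (x - z) := by abel
    have := norm_sub_le (x + y) (x - z)
    rw [← e] at this
    linarith
  have h4 : (η / 2) ^ 2 ≤ den x y :=
    (pow_le_pow_left₀ (by positivity) h3 2).trans (norm_add_sq_le_den hx.le hy)
  refine ⟨h4, ?_⟩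
  have h5 : 1 - ‖x‖ ^ 2 ≤ 2 * ‖x - z‖ := by
    have := norm_sub_norm_le z x
    rw [hz, norm_sub_rev] at this
    nlinarith [norm_nonneg x]
  have h6 : ‖moebius x y - x‖ ≤ 16 / η ^ 2 * ‖x - z‖ := by
    refine (norm_moebius_sub_le hx hy).trans ?_
    have h8 := one_sub_norm_sq_pos hx
    calc 2 * (1 - ‖x‖ ^ 2) / den x y ≤ 2 * (2 * ‖x - z‖) / (η / 2) ^ 2 := by gcongr
      _ = 16 / η ^ 2 * ‖x - z‖ := by field_simp; ring
  calc ‖moebius x y - z‖ = ‖(moebius x y - x) + (x - z)‖ := by congr 1; abel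
    _ ≤ ‖moebius x y - x‖ + ‖x - z‖ := norm_add_le _ _
    _ ≤ ‖x - z‖ * (1 + 16 / η ^ 2) := by linarith
    _ < ε := h2

lemma radialField_of_norm_eq_one (g : ℝ → ℝ) {z : EuclideanSpace ℝ (Fin n)} (hz : ‖z‖ = 1) :
    radialField g z = g 1 • z := by
  rw [radialField_eq, hz, div_one]

lemma inner_radialField_self (g : ℝ → ℝ) {z : EuclideanSpace ℝ (Fin n)} (hz : ‖z‖ = 1) :
    inner ℝ z (radialField g z) = g 1 := by
  rw [radialField_of_norm_eq_one g hz, inner_smul_right, real_inner_self_eq_norm_sq, hz]; ring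

lemma abs_inner_radialField_le (g : ℝ → ℝ) {z : EuclideanSpace ℝ (Fin n)} (hz : ‖z‖ = 1)
    (w : EuclideanSpace ℝ (Fin n)) : |inner ℝ z (radialField g w)| ≤ |g ‖w‖| := by
  refine (abs_real_inner_le_norm _ _).trans ?_
  rw [hz, one_mul]
  exact norm_radialField_le g w

lemma norm_radialField_sub_le (g h : ℝ → ℝ) (w : EuclideanSpace ℝ (Fin n)) :
    ‖radialField g w - radialField h w‖ ≤ |g ‖w‖ - h ‖w‖| := by
  have : radialField g w - radialField h w = radialField (fun t => g t - h t) w := by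
    simp only [radialField_eq]
    rw [← sub_smul, sub_div]
  rw [this]
  exact norm_radialField_le _ w

lemma integral_inner_of_isCenter {g : ℝ → ℝ} (hg : Continuous g) (hg0 : g 0 = 0)
    {μ : FiniteMeasure (ClosedUnitBall n)} {x : EuclideanSpace ℝ (Fin n)} (h : IsCenter g μ x)
    (e : EuclideanSpace ℝ (Fin n)) :
    ∫ y : ClosedUnitBall n, inner ℝ e (radialField g (moebius x y))
      ∂(μ : Measure (ClosedUnitBall n)) = 0 := by
  have b := mem_ball_zero_iff.1 h.1
  have i := integrable_of_continuous μ (continuous_radialField_moebius hg hg0 b)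
  have z := h.2
  unfold centerField at z
  rw [integral_inner (𝕜 := ℝ) i e, z, inner_zero_right]

/-! ### Limits of centers -/

lemma tendsto_integral_of_tendsto {μs : ℕ → FiniteMeasure (ClosedUnitBall n)}
    {μ : FiniteMeasure (ClosedUnitBall n)} (h : Tendsto μs atTop (𝓝 μ))
    {f : ClosedUnitBall n → ℝ} (hf : Continuous f) :
    Tendsto (fun k => ∫ y, f y ∂(μs k : Measure (ClosedUnitBall n))) atTop
      (𝓝 (∫ y, f y ∂(μ : Measure (ClosedUnitBall n)))) :=
  FiniteMeasure.tendsto_iff_forall_integral_tendsto.1 h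
    (BoundedContinuousFunction.mkOfCompact ⟨f, hf⟩)

lemma tendsto_real_univ {μs : ℕ → FiniteMeasure (ClosedUnitBall n)}
    {μ : FiniteMeasure (ClosedUnitBall n)} (h : Tendsto μs atTop (𝓝 μ)) :
    Tendsto (fun k => (μs k : Measure (ClosedUnitBall n)).real Set.univ) atTop
      (𝓝 ((μ : Measure (ClosedUnitBall n)).real Set.univ)) := by
  simpa using tendsto_integral_of_tendsto h (continuous_const (y := (1 : ℝ)))

/-- Limits in the open ball of centers are centers. -/
lemma isCenter_of_tendsto {g : ℝ → ℝ} (hg : Continuous g) (hg0 : g 0 = 0)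
    {gs : ℕ → ℝ → ℝ} (hgs : ∀ k, Continuous (gs k)) (hgs0 : ∀ k, gs k 0 = 0) {ε : ℕ → ℝ}
    (hε : Tendsto ε atTop (𝓝 0)) (hgε : ∀ k, ∀ t ∈ Set.Icc (0 : ℝ) 1, |gs k t - g t| ≤ ε k)
    {μs : ℕ → FiniteMeasure (ClosedUnitBall n)} {μ : FiniteMeasure (ClosedUnitBall n)}
    (hμ : Tendsto μs atTop (𝓝 μ)) {xs : ℕ → EuclideanSpace ℝ (Fin n)}
    {x : EuclideanSpace ℝ (Fin n)} (hx : ‖x‖ < 1) (hxs : Tendsto xs atTop (𝓝 x))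
    (hc : ∀ k, IsCenter (gs k) (μs k) (xs k)) : IsCenter g μ x := by
  refine ⟨mem_ball_zero_iff.2 hx, ?_⟩
  have hb : ∀ k, ‖xs k‖ < 1 := fun k => mem_ball_zero_iff.1 (hc k).1
  -- Currying over the compact closed ball turns joint continuity into uniform convergence in `y`,
  -- which is what integration against varying measures requires.
  let F : C(Metric.ball (0 : EuclideanSpace ℝ (Fin n)) 1 × ClosedUnitBall n,
      EuclideanSpace ℝ (Fin n)) :=
    ⟨_, (continuous_radialField hg hg0).comp continuous_moebius_ball⟩
  let X : ℕ → Metric.ball (0 : EuclideanSpace ℝ (Fin n)) 1 := fun k => ⟨xs k, (hc k).1⟩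
  let X₀ : Metric.ball (0 : EuclideanSpace ℝ (Fin n)) 1 := ⟨x, mem_ball_zero_iff.2 hx⟩
  have hX : Tendsto X atTop (𝓝 X₀) := tendsto_subtype_rng.2 hxs
  have hd : Tendsto (fun k => dist (F.curry (X k)) (F.curry X₀)) atTop (𝓝 0) :=
    tendsto_iff_dist_tendsto_zero.1 ((F.curry.continuous.tendsto X₀).comp hX)
  refine ext_inner_left ℝ fun e => ?_
  rw [inner_zero_right]
  have i := continuous_radialField_moebius hg hg0 hx
  unfold centerField
  rw [← integral_inner (𝕜 := ℝ) (integrable_of_continuous μ i) e]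
  refine tendsto_nhds_unique (tendsto_integral_of_tendsto hμ (continuous_const.inner i)) ?_
  refine squeeze_zero_norm (a := fun k => ‖e‖ * (dist (F.curry (X k)) (F.curry X₀) + ε k) *
    (μs k : Measure (ClosedUnitBall n)).real Set.univ) (fun k => ?_) ?_
  · have i' := continuous_radialField_moebius (hgs k) (hgs0 k) (hb k)
    have j := integrable_of_continuous (μs k) (continuous_const.inner (𝕜 := ℝ) (f := fun _ => e) i)
    have j' := integrable_of_continuous (μs k)
      (continuous_const.inner (𝕜 := ℝ) (f := fun _ => e) i')
    have e1 := integral_sub j j'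
    rw [integral_inner_of_isCenter (hgs k) (hgs0 k) (hc k) e, sub_zero] at e1
    rw [← e1]
    refine norm_integral_le_of_norm_le_const (Eventually.of_forall fun y => ?_)
    rw [← inner_sub_right]
    refine (norm_inner_le_norm _ _).trans ?_
    gcongr
    have h1 : ‖radialField g (moebius (xs k) y) - radialField g (moebius x y)‖ ≤
        dist (F.curry (X k)) (F.curry X₀) := by
      rw [← dist_eq_norm]
      exact ContinuousMap.dist_apply_le_dist (f := F.curry (X k)) (g := F.curry X₀) y
    have h2 := (norm_radialField_sub_le (gs k) g (moebius (xs k) y)).trans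
      (hgε k _ ⟨norm_nonneg _, norm_moebius_le_one (hb k) (norm_coe_le_one y)⟩)
    calc _ = ‖(radialField g (moebius (xs k) y) - radialField g (moebius x y)) +
          (radialField (gs k) (moebius (xs k) y) - radialField g (moebius (xs k) y))‖ := by
            rw [← norm_neg]; congr 1; abel
      _ ≤ _ := (norm_add_le _ _).trans (add_le_add h1 h2)
  · have := ((hd.add hε).const_mul ‖e‖).mul (tendsto_real_univ hμ)
    simpa using this

/-- For monotone `g`, centers of a convergent sequence of measures do not
accumulate at the boundary. -/
lemma not_tendsto_boundary_of_monotone {g : ℝ → ℝ} (hg : Continuous g) (hg0 : g 0 = 0)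
    (hmono : MonotoneOn g (Set.Icc 0 1)) (hg1 : 0 < g 1)
    {μs : ℕ → FiniteMeasure (ClosedUnitBall n)} {μ : FiniteMeasure (ClosedUnitBall n)}
    (hadm : Admissible μ) (hμ : Tendsto μs atTop (𝓝 μ)) {xs : ℕ → EuclideanSpace ℝ (Fin n)}
    {z : EuclideanSpace ℝ (Fin n)} (hz : ‖z‖ = 1) (hc : ∀ k, IsCenter g (μs k) (xs k)) :
    ¬ Tendsto xs atTop (𝓝 z) := by
  intro hxs
  have hb : ∀ k, ‖xs k‖ < 1 := fun k => mem_ball_zero_iff.1 (hc k).1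
  obtain ⟨η, hη, φ, hφ, hφ0, hφ1, hφm⟩ := exists_cutoff hadm (p := -z) (by rwa [norm_neg])
  set m := (μ : Measure (ClosedUnitBall n)).real Set.univ with hm
  set I := ∫ y, φ y ∂(μ : Measure (ClosedUnitBall n)) with hI
  have hm0 : 0 < m := hadm.real_univ_pos
  -- This choice makes (g(1) - ε) m - 2 g(1) I positive. The proof bounds the integrand below by
  -- g(1) - ε - 2 g(1) φ, so a center would make that limit nonpositive.
  obtain ⟨ε, hε, hεm⟩ : ∃ ε > 0, ε * m < g 1 * (m - 2 * I) := by
    have : 0 < g 1 * (m - 2 * I) := mul_pos hg1 (by linarith)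
    exact ⟨g 1 * (m - 2 * I) / (2 * m), by positivity, by
      rw [div_mul_eq_mul_div, div_lt_iff₀ (by positivity)]; nlinarith⟩
  have hcont : Continuous fun w : EuclideanSpace ℝ (Fin n) => inner ℝ z (radialField g w) :=
    continuous_const.inner (continuous_radialField hg hg0)
  obtain ⟨δ, hδ, hδε⟩ := Metric.continuousAt_iff.1 (hcont.continuousAt (x := z)) ε hε
  obtain ⟨δ', hδ', hnear⟩ := exists_moebius_near hz hη hδ
  have hev : ∀ᶠ k in atTop, (g 1 - ε) * (μs k : Measure (ClosedUnitBall n)).real Set.univ -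
      2 * g 1 * ∫ y, φ y ∂(μs k : Measure (ClosedUnitBall n)) ≤ 0 := by
    filter_upwards [hxs.eventually (Metric.ball_mem_nhds z hδ')] with k hk
    rw [dist_eq_norm] at hk
    have iφ := integrable_of_continuous (μs k) hφ
    have i' := integrable_of_continuous (μs k) (continuous_const.inner (𝕜 := ℝ) (f := fun _ => z)
      (continuous_radialField_moebius hg hg0 (hb k)))
    rw [← integral_inner_of_isCenter hg hg0 (hc k) z, ← integral_const_mul]
    have e1 : (g 1 - ε) * (μs k : Measure (ClosedUnitBall n)).real Set.univ =
        ∫ _, (g 1 - ε) ∂(μs k : Measure (ClosedUnitBall n)) := by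
      rw [integral_const, smul_eq_mul, mul_comm]
    rw [e1, ← integral_sub (integrable_const _) (iφ.const_mul _)]
    refine integral_mono ((integrable_const _).sub (iφ.const_mul _)) i' fun y => ?_
    -- Near `-z` only the crude bound -g(1) is available, by monotonicity of `g`; elsewhere `T_x y`
    -- is close to `z`.
    rcases lt_or_ge ‖(y : EuclideanSpace ℝ (Fin n)) - -z‖ η with hy | hy
    · have h1 := hφ1 y hy
      have t1 := norm_moebius_le_one (hb k) (norm_coe_le_one y)
      have h2 := (abs_le.1 (abs_inner_radialField_le g hz (moebius (xs k) y))).1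
      have h3 : 0 ≤ g ‖moebius (xs k) y‖ :=
        hg0 ▸ hmono (by simp) ⟨norm_nonneg _, t1⟩ (norm_nonneg _)
      have h4 : g ‖moebius (xs k) y‖ ≤ g 1 := hmono ⟨norm_nonneg _, t1⟩ (by simp) t1
      rw [abs_of_nonneg h3] at h2
      simp only [h1]
      linarith
    · have h1 := (hnear (xs k) y (hb k) (norm_coe_le_one y) hk hy).2
      rw [← dist_eq_norm] at h1
      have h2 := hδε h1
      rw [inner_radialField_self g hz, Real.dist_eq] at h2
      have h3 := (abs_lt.1 h2).1
      have h4 := mul_nonneg hg1.le (hφ0 y)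
      simp only
      linarith
  have hlim := ((tendsto_real_univ hμ).const_mul (g 1 - ε)).sub
    ((tendsto_integral_of_tendsto hμ hφ).const_mul (2 * g 1))
  have := le_of_tendsto hlim hev
  nlinarith

/-- For a fixed measure, zeros of approximating fields do not accumulate at the boundary. -/
lemma not_tendsto_boundary_of_approx {g : ℝ → ℝ} (hg : Continuous g) (hg0 : g 0 = 0)
    (hg1 : 0 < g 1) {gs : ℕ → ℝ → ℝ} (hgs : ∀ k, Continuous (gs k)) (hgs0 : ∀ k, gs k 0 = 0)
    {ε : ℕ → ℝ} (hε : Tendsto ε atTop (𝓝 0))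
    (hgε : ∀ k, ∀ t ∈ Set.Icc (0 : ℝ) 1, |gs k t - g t| ≤ ε k)
    {μ : FiniteMeasure (ClosedUnitBall n)}
    (hadm : Admissible μ) {xs : ℕ → EuclideanSpace ℝ (Fin n)}
    {z : EuclideanSpace ℝ (Fin n)} (hz : ‖z‖ = 1) (hc : ∀ k, IsCenter (gs k) μ (xs k)) :
    ¬ Tendsto xs atTop (𝓝 z) := by
  intro hxs
  have hb : ∀ k, ‖xs k‖ < 1 := fun k => mem_ball_zero_iff.1 (hc k).1
  let p : ClosedUnitBall n := ⟨-z, mem_closedBall_zero_iff.2 (by rw [norm_neg, hz])⟩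
  have hp : ‖(p : EuclideanSpace ℝ (Fin n))‖ = 1 := by simp only [p]; rwa [norm_neg]
  let f : ℕ → ClosedUnitBall n → ℝ := fun k y => inner ℝ z (radialField (gs k) (moebius (xs k) y))
  have hfc : ∀ k, Continuous (f k) := fun k =>
    continuous_const.inner (continuous_radialField_moebius (hgs k) (hgs0 k) (hb k))
  obtain ⟨B, hB⟩ := hε.bddAbove_range
  obtain ⟨M, hM⟩ := (isCompact_Icc (a := (0 : ℝ)) (b := 1)).exists_bound_of_continuousOn
    hg.continuousOn
  have hfB : ∀ k y, |f k y| ≤ M + B := fun k y => by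
    have ht : ‖moebius (xs k) (y : EuclideanSpace ℝ (Fin n))‖ ∈ Set.Icc (0 : ℝ) 1 :=
      ⟨norm_nonneg _, norm_moebius_le_one (hb k) (norm_coe_le_one y)⟩
    refine (abs_inner_radialField_le (gs k) hz _).trans ?_
    have h1 := hgε k _ ht
    have h2 := hM _ ht
    have h3 : ε k ≤ B := hB ⟨k, rfl⟩
    rw [Real.norm_eq_abs] at h2
    have h4 := abs_add_le (gs k ‖moebius (xs k) y‖ - g ‖moebius (xs k) y‖) (g ‖moebius (xs k) y‖)
    rw [sub_add_cancel] at h4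
    linarith
  have hcont : Continuous fun w : EuclideanSpace ℝ (Fin n) => inner ℝ z (radialField g w) :=
    continuous_const.inner (continuous_radialField hg hg0)
  have hpt : ∀ y : ClosedUnitBall n, y ≠ p → Tendsto (fun k => f k y) atTop (𝓝 (g 1)) := by
    intro y hy
    have hη : 0 < ‖(y : EuclideanSpace ℝ (Fin n)) - -z‖ :=
      norm_pos_iff.2 (sub_ne_zero.2 fun h => hy (Subtype.ext h))
    have h1 : Tendsto (fun k => moebius (xs k) (y : EuclideanSpace ℝ (Fin n))) atTop (𝓝 z) := by
      rw [Metric.tendsto_nhds]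
      intro r hr
      obtain ⟨δ, hδ, hnear⟩ := exists_moebius_near hz hη hr
      filter_upwards [hxs.eventually (Metric.ball_mem_nhds z hδ)] with k hk
      rw [dist_eq_norm] at hk
      rw [dist_eq_norm]
      exact (hnear (xs k) y (hb k) (norm_coe_le_one y) hk le_rfl).2
    have h2 := (hcont.tendsto z).comp h1
    rw [inner_radialField_self g hz] at h2
    have h3 : Tendsto (fun k => f k y - inner ℝ z (radialField g (moebius (xs k) y))) atTop
        (𝓝 0) := by
      refine squeeze_zero_norm (fun k => ?_) hε
      simp only [f]
      rw [← inner_sub_right]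
      refine (norm_inner_le_norm _ _).trans ?_
      rw [hz, one_mul]
      exact (norm_radialField_sub_le _ _ _).trans
        (hgε k _ ⟨norm_nonneg _, norm_moebius_le_one (hb k) (norm_coe_le_one y)⟩)
    simpa using h3.add h2
  -- For a fixed measure, dominated convergence isolates the single point `p = -z`, so no
  -- neighborhood of it has to be controlled.
  have hlim : Tendsto (fun k => ∫ y, ({p}ᶜ : Set (ClosedUnitBall n)).indicator (f k) y
      ∂(μ : Measure (ClosedUnitBall n))) atTop
      (𝓝 (∫ y, ({p}ᶜ : Set (ClosedUnitBall n)).indicator (fun _ => g 1) y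
        ∂(μ : Measure (ClosedUnitBall n)))) := by
    refine tendsto_integral_of_dominated_convergence (fun _ => M + B)
      (fun k => (hfc k).aestronglyMeasurable.indicator (measurableSet_singleton p).compl)
      (integrable_const _) (fun k => Eventually.of_forall fun y => ?_)
      (Eventually.of_forall fun y => ?_)
    · exact (norm_indicator_le_norm_self _ _).trans (hfB k y)
    · by_cases hy : y = p
      · simp [hy]
      · have : y ∈ ({p}ᶜ : Set (ClosedUnitBall n)) := hy
        simp only [Set.indicator_of_mem this]
        exact hpt y hy
  rw [integral_indicator_const _ (measurableSet_singleton p).compl, smul_eq_mul,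
    measureReal_compl (measurableSet_singleton p)] at hlim
  have hgs1 : Tendsto (fun k => gs k 1) atTop (𝓝 (g 1)) := by
    rw [tendsto_iff_norm_sub_tendsto_zero]
    exact squeeze_zero (fun _ => norm_nonneg _) (fun k => hgε k 1 (by simp)) hε
  have hle : ∀ k, ∫ y, ({p}ᶜ : Set (ClosedUnitBall n)).indicator (f k) y
      ∂(μ : Measure (ClosedUnitBall n)) ≤ |gs k 1| * (μ : Measure (ClosedUnitBall n)).real {p} := by
    intro k
    have h1 := integral_add_compl (measurableSet_singleton p) (integrable_of_continuous μ (hfc k))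
    have h2 : ∫ y, f k y ∂(μ : Measure (ClosedUnitBall n)) = 0 :=
      integral_inner_of_isCenter (hgs k) (hgs0 k) (hc k) z
    rw [h2, integral_singleton, smul_eq_mul] at h1
    rw [integral_indicator (measurableSet_singleton p).compl]
    -- `T_x` preserves the sphere, so only the profile value at 1 enters at the atom and
    -- monotonicity is not needed.
    have h3 : |f k p| ≤ |gs k 1| := by
      have := abs_inner_radialField_le (gs k) hz (moebius (xs k) p)
      rwa [norm_moebius_eq_one (hb k) hp] at this
    have h4 := (abs_le.1 h3).1
    have h5 : 0 ≤ (μ : Measure (ClosedUnitBall n)).real {p} := measureReal_nonneg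
    nlinarith
  have hfin := le_of_tendsto_of_tendsto' hlim
    (hgs1.abs.mul_const ((μ : Measure (ClosedUnitBall n)).real {p})) hle
  rw [abs_of_pos hg1] at hfin
  have h6 := hadm.two_mul_real_lt hp
  nlinarith

/-! ### Variational existence for special profiles -/

/-- The Busemann-type function whose gradient at `x` is `2 T_x(y) / (1 - ‖x‖²)`. -/
noncomputable def busemann (x y : EuclideanSpace ℝ (Fin n)) : ℝ :=
  Real.log (den x y) - Real.log (1 - ‖x‖ ^ 2)

/-- The integrand of the energy of the radial field with profile `r (a + (1 - r²) q(r²))`. -/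
noncomputable def energyDensity (a : ℝ) (q : ℝ → ℝ) (x y : EuclideanSpace ℝ (Fin n)) : ℝ :=
  a * busemann x y + ∫ ρ in (0 : ℝ)..‖moebius x y‖ ^ 2, q ρ

/-- The radial profile `r (a + (1 - r²) q(r²))`. -/
noncomputable def profile (a : ℝ) (q : ℝ → ℝ) (r : ℝ) : ℝ :=
  r * (a + (1 - r ^ 2) * q (r ^ 2))

lemma continuous_profile (a : ℝ) {q : ℝ → ℝ} (hq : Continuous q) : Continuous (profile a q) := by
  unfold profile; fun_prop

lemma profile_zero (a : ℝ) (q : ℝ → ℝ) : profile a q 0 = 0 := by simp [profile]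

lemma continuous_primitive {q : ℝ → ℝ} (hq : Continuous q) :
    Continuous fun s => ∫ ρ in (0 : ℝ)..s, q ρ :=
  intervalIntegral.continuous_primitive (fun _ _ => hq.intervalIntegrable _ _) 0

lemma continuous_energyDensity (a : ℝ) {q : ℝ → ℝ} (hq : Continuous q) :
    Continuous (fun p : Metric.ball (0 : EuclideanSpace ℝ (Fin n)) 1 × ClosedUnitBall n =>
      energyDensity a q (p.1 : EuclideanSpace ℝ (Fin n)) (p.2 : EuclideanSpace ℝ (Fin n))) := by
  have h1 : Continuous (fun p : Metric.ball (0 : EuclideanSpace ℝ (Fin n)) 1 × ClosedUnitBall n =>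
      den (p.1 : EuclideanSpace ℝ (Fin n)) (p.2 : EuclideanSpace ℝ (Fin n))) := by
    unfold den; fun_prop
  have h2 : Continuous (fun p : Metric.ball (0 : EuclideanSpace ℝ (Fin n)) 1 × ClosedUnitBall n =>
      1 - ‖(p.1 : EuclideanSpace ℝ (Fin n))‖ ^ 2) := by fun_prop
  have h3 := h1.log fun p => (den_pos (mem_ball_zero_iff.1 p.1.2) (norm_coe_le_one p.2)).ne'
  have h4 := h2.log fun p => (one_sub_norm_sq_pos (mem_ball_zero_iff.1 p.1.2)).ne'
  have h5 := (continuous_primitive hq).comp (continuous_moebius_ball (n := n).norm.pow 2)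
  exact ((h3.sub h4).const_mul a).add h5

lemma continuous_energyDensity_right (a : ℝ) {q : ℝ → ℝ} (hq : Continuous q)
    {x : EuclideanSpace ℝ (Fin n)} (hx : ‖x‖ < 1) :
    Continuous fun y : ClosedUnitBall n => energyDensity a q x y := by
  have h2 : Continuous fun y : ClosedUnitBall n =>
      ((⟨x, mem_ball_zero_iff.2 hx⟩ : Metric.ball (0 : EuclideanSpace ℝ (Fin n)) 1), y) := by
    fun_prop
  have h := (continuous_energyDensity a hq).comp h2
  exact h

/-- Both ‖T_x y‖² and the Busemann term have gradients proportional to `T_x y`, with factors (1 -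
‖T_x y‖²)·2/(1 - ‖x‖²) and 2/(1 - ‖x‖²). This dictates the form of `profile`. -/
lemma hasDerivAt_energyDensity (a : ℝ) {q : ℝ → ℝ} (hq : Continuous q)
    {x e y : EuclideanSpace ℝ (Fin n)} {t : ℝ} (hx : ‖x + t • e‖ < 1) (hy : ‖y‖ ≤ 1) :
    HasDerivAt (fun s : ℝ => energyDensity a q (x + s • e) y)
      (2 / (1 - ‖x + t • e‖ ^ 2) *
        inner ℝ e (radialField (profile a q) (moebius (x + t • e) y))) t := by
  set X := x + t • e with hX
  have hline : HasDerivAt (fun s : ℝ => x + s • e) e t := by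
    simpa using ((hasDerivAt_id t).smul_const e).const_add x
  have hA : HasDerivAt (fun s : ℝ => ‖x + s • e‖ ^ 2) (2 * inner ℝ X e) t := hline.norm_sq
  have hI : HasDerivAt (fun s : ℝ => inner ℝ (x + s • e) y) (inner ℝ e y) t := by
    have := hline.inner ℝ (hasDerivAt_const t y)
    simpa using this
  have hD : HasDerivAt (fun s : ℝ => den (x + s • e) y)
      (2 * inner ℝ e y + 2 * inner ℝ X e * ‖y‖ ^ 2) t := by
    unfold den
    exact ((hI.const_mul 2).const_add 1).add (hA.mul_const _)
  have dpos := den_pos hx hy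
  have apos := one_sub_norm_sq_pos hx
  have hN : HasDerivAt (fun s : ℝ => 1 - ‖x + s • e‖ ^ 2) (-(2 * inner ℝ X e)) t :=
    hA.const_sub 1
  have hB : HasDerivAt (fun s : ℝ => busemann (x + s • e) y)
      (2 / (1 - ‖X‖ ^ 2) * inner ℝ e (moebius X y)) t := by
    unfold busemann
    convert! (hD.log dpos.ne').sub (hN.log apos.ne') using 1
    rw [moebius_eq, inner_smul_right, inner_add_right, inner_smul_right, inner_smul_right,
      real_inner_comm X e, ← hX]
    field_simp
    simp only [den]
    ring
  have hR : HasDerivAt (fun s : ℝ => ‖moebius (x + s • e) y‖ ^ 2)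
      ((1 - ‖moebius X y‖ ^ 2) * (2 / (1 - ‖X‖ ^ 2) * inner ℝ e (moebius X y))) t := by
    have h1 : HasDerivAt (fun s : ℝ => 1 - (1 - ‖x + s • e‖ ^ 2) * (1 - ‖y‖ ^ 2) /
        den (x + s • e) y) ((1 - ‖moebius X y‖ ^ 2) *
          (2 / (1 - ‖X‖ ^ 2) * inner ℝ e (moebius X y))) t := by
      convert! ((hN.mul_const (1 - ‖y‖ ^ 2)).div hD dpos.ne').const_sub 1 using 1
      rw [one_sub_norm_moebius_sq hx hy, moebius_eq, inner_smul_right, inner_add_right,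
        inner_smul_right, inner_smul_right, real_inner_comm X e, ← hX]
      field_simp
      simp only [den]
      ring
    refine h1.congr_of_eventuallyEq ?_
    have hopen : ∀ᶠ s in 𝓝 t, ‖x + s • e‖ < 1 := by
      have : Continuous fun s : ℝ => ‖x + s • e‖ := by fun_prop
      exact this.continuousAt.eventually (gt_mem_nhds hx)
    filter_upwards [hopen] with s hs
    rw [← one_sub_norm_moebius_sq hs hy]; ring
  have hH := (intervalIntegral.integral_hasDerivAt_right (hq.intervalIntegrable 0 _)
    (hq.stronglyMeasurableAtFilter _ _) hq.continuousAt).comp t hR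
  unfold energyDensity
  convert! (hB.const_mul a).add hH using 1
  by_cases h0 : moebius X y = 0
  · simp [h0, radialField_zero]
  · have : ‖moebius X y‖ ≠ 0 := norm_ne_zero_iff.2 h0
    rw [radialField_eq, inner_smul_right, profile, ← hX]
    field_simp

/-- The energy whose critical points are the zeros of the center field. -/
noncomputable def energy (a : ℝ) (q : ℝ → ℝ) (μ : FiniteMeasure (ClosedUnitBall n))
    (x : EuclideanSpace ℝ (Fin n)) : ℝ :=
  ∫ y : ClosedUnitBall n, energyDensity a q x y ∂(μ : Measure (ClosedUnitBall n))

lemma continuousOn_energy (a : ℝ) {q : ℝ → ℝ} (hq : Continuous q)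
    (μ : FiniteMeasure (ClosedUnitBall n)) :
    ContinuousOn (energy a q μ) (Metric.ball 0 1) := by
  rw [continuousOn_iff_continuous_domRestrict]
  have : LocallyCompactSpace (Metric.ball (0 : EuclideanSpace ℝ (Fin n)) 1) :=
    Metric.isOpen_ball.locallyCompactSpace
  have h0 := continuous_energyDensity (n := n) a hq
  have h1 : Continuous (Function.uncurry
      fun (x : Metric.ball (0 : EuclideanSpace ℝ (Fin n)) 1) (y : ClosedUnitBall n) =>
        energyDensity a q (x : EuclideanSpace ℝ (Fin n)) (y : EuclideanSpace ℝ (Fin n))) := h0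
  have h2 := continuous_parametric_integral_of_continuous
    (μ := (μ : Measure (ClosedUnitBall n))) h1 isCompact_univ
  refine h2.congr fun x => ?_
  rw [Measure.restrict_univ]
  rfl

lemma hasDerivAt_energy (a : ℝ) {q : ℝ → ℝ} (hq : Continuous q)
    (μ : FiniteMeasure (ClosedUnitBall n)) {x : EuclideanSpace ℝ (Fin n)} (hx : ‖x‖ < 1)
    (e : EuclideanSpace ℝ (Fin n)) :
    HasDerivAt (fun t : ℝ => energy a q μ (x + t • e))
      (2 / (1 - ‖x‖ ^ 2) * inner ℝ e (centerField (profile a q) μ x)) 0 := by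
  -- Staying inside radius `r < 1` bounds the factor 2/(1 - ‖x + t e‖²) and so provides a dominating
  -- constant.
  obtain ⟨r, hxr, hr1⟩ := exists_between hx
  have hr0 : 0 ≤ r := (norm_nonneg x).trans hxr.le
  have hp := continuous_profile a hq
  have hp0 := profile_zero a q
  obtain ⟨C, hC⟩ := (isCompact_Icc (a := (0 : ℝ)) (b := 1)).exists_bound_of_continuousOn
    hp.continuousOn
  have hcont : Continuous fun s : ℝ => ‖x + s • e‖ := by fun_prop
  have hs : {t : ℝ | ‖x + t • e‖ < r} ∈ 𝓝 (0 : ℝ) :=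
    hcont.continuousAt.eventually (gt_mem_nhds (by simpa using hxr))
  have h := hasDerivAt_integral_of_dominated_loc_of_deriv_le
    (μ := (μ : Measure (ClosedUnitBall n))) (F := fun (t : ℝ) (y : ClosedUnitBall n) =>
      energyDensity a q (x + t • e) y)
    (F' := fun (t : ℝ) (y : ClosedUnitBall n) => 2 / (1 - ‖x + t • e‖ ^ 2) *
        inner ℝ e (radialField (profile a q) (moebius (x + t • e) y)))
    (bound := fun _ => 2 / (1 - r ^ 2) * (‖e‖ * C)) hs ?_ ?_ ?_ ?_ (integrable_const _) ?_
  · convert! h.2 using 1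
    have hx0 : x + (0 : ℝ) • e = x := by simp
    simp only [hx0]
    rw [integral_const_mul, centerField, integral_inner (𝕜 := ℝ)
      (integrable_of_continuous μ (continuous_radialField_moebius hp hp0 hx)) e]
  · filter_upwards [hs] with t ht
    exact (continuous_energyDensity_right a hq (lt_trans ht hr1)).aestronglyMeasurable
  · simpa using integrable_of_continuous μ (continuous_energyDensity_right a hq hx)
  · have : Continuous fun y : ClosedUnitBall n => 2 / (1 - ‖x + (0 : ℝ) • e‖ ^ 2) *
        inner ℝ e (radialField (profile a q) (moebius (x + (0 : ℝ) • e) y)) :=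
      (continuous_const.inner
        (continuous_radialField_moebius hp hp0 (by simpa using hx))).const_mul _
    exact this.aestronglyMeasurable
  · refine Eventually.of_forall fun y t ht => ?_
    have ht' : ‖x + t • e‖ < r := ht
    have h1 : 0 < 1 - r ^ 2 := by nlinarith
    have h2 : ‖x + t • e‖ ^ 2 ≤ r ^ 2 := pow_le_pow_left₀ (norm_nonneg _) ht'.le 2
    rw [norm_mul, Real.norm_of_nonneg (div_nonneg zero_le_two (by linarith))]
    gcongr
    refine (norm_inner_le_norm _ _).trans ?_
    gcongr
    exact (norm_radialField_le _ _).trans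
      (hC _ ⟨norm_nonneg _, norm_moebius_le_one (ht'.trans hr1) (norm_coe_le_one y)⟩)
  · exact Eventually.of_forall fun y t ht =>
      hasDerivAt_energyDensity a hq (lt_trans ht hr1) (norm_coe_le_one y)

lemma isCenter_of_isLocalMin (a : ℝ) {q : ℝ → ℝ} (hq : Continuous q)
    {μ : FiniteMeasure (ClosedUnitBall n)} {x : EuclideanSpace ℝ (Fin n)} (hx : ‖x‖ < 1)
    (h : IsLocalMin (energy a q μ) x) : IsCenter (profile a q) μ x := by
  refine ⟨mem_ball_zero_iff.2 hx, ext_inner_left ℝ fun e => ?_⟩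
  have h1 : IsLocalMin (fun t : ℝ => energy a q μ (x + t • e)) 0 := by
    have hc : Tendsto (fun t : ℝ => x + t • e) (𝓝 0) (𝓝 x) := by
      have : Continuous fun t : ℝ => x + t • e := by fun_prop
      simpa using this.tendsto 0
    have := hc.eventually h
    unfold IsLocalMin IsMinFilter
    simpa using this
  have h2 := h1.hasDerivAt_eq_zero (hasDerivAt_energy a hq μ hx e)
  have h3 := one_sub_norm_sq_pos hx
  rw [inner_zero_right]
  exact (mul_eq_zero.1 h2).resolve_left (by positivity)

/-- The energy tends to infinity at every boundary point. -/
lemma eventually_energy_gt {a : ℝ} (ha : 0 < a) {q : ℝ → ℝ} (hq : Continuous q)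
    {μ : FiniteMeasure (ClosedUnitBall n)} (hadm : Admissible μ)
    {z : EuclideanSpace ℝ (Fin n)} (hz : ‖z‖ = 1) (K : ℝ) :
    ∀ᶠ x in 𝓝 z, ‖x‖ < 1 → K < energy a q μ x := by
  obtain ⟨η, hη, φ, hφ, hφ0, hφ1, hφm⟩ := exists_cutoff hadm (p := -z) (by rwa [norm_neg])
  set m := (μ : Measure (ClosedUnitBall n)).real Set.univ with hm
  set I := ∫ y, φ y ∂(μ : Measure (ClosedUnitBall n)) with hI
  obtain ⟨δ, hδ, hnear⟩ := exists_moebius_near hz hη one_pos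
  obtain ⟨B, hB⟩ := (isCompact_Icc (a := (0 : ℝ)) (b := 1)).exists_bound_of_continuousOn
    (continuous_primitive hq).continuousOn
  set C := Real.log 2 + |Real.log ((η / 2) ^ 2)| with hC
  have hlog2 : 0 ≤ Real.log 2 := Real.log_nonneg one_le_two
  have key : ∀ x : EuclideanSpace ℝ (Fin n), ‖x‖ < 1 → ‖x - z‖ < δ →
      a * ((-Real.log (1 - ‖x‖) - C) * m - 2 * -Real.log (1 - ‖x‖) * I) - B * m ≤
        energy a q μ x := by
    intro x hx hxz
    set L := -Real.log (1 - ‖x‖) with hL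
    have hx1 : 0 < 1 - ‖x‖ := sub_pos.2 hx
    have hL0 : 0 ≤ L := neg_nonneg.2 (Real.log_nonpos hx1.le (by linarith [norm_nonneg x]))
    have hlog : Real.log (1 - ‖x‖ ^ 2) ≤ Real.log 2 - L := by
      have e : 1 - ‖x‖ ^ 2 ≤ 2 * (1 - ‖x‖) := by nlinarith [norm_nonneg x]
      have := Real.log_le_log (one_sub_norm_sq_pos hx) e
      rw [Real.log_mul two_ne_zero hx1.ne'] at this
      linarith
    -- Away from `-z` the function grows like `L`; near `-z` the bound `den ≥ (1 - ‖x‖)²` costs at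
    -- most 2L. Since 2I < m, the integrated bound tends to infinity with `L`.
    have hbus : ∀ y : ClosedUnitBall n, L - C - 2 * L * φ y ≤ busemann x y := by
      intro y
      rw [busemann]
      rcases lt_or_ge ‖(y : EuclideanSpace ℝ (Fin n)) - -z‖ η with hy | hy
      · have h1 := Real.log_le_log (by positivity)
          (one_sub_norm_sq_le_den hx.le (norm_coe_le_one y))
        rw [Real.log_pow] at h1
        push_cast at h1
        rw [hφ1 y hy]
        have := abs_nonneg (Real.log ((η / 2) ^ 2))
        linarith
      · have h1 := Real.log_le_log (by positivity)
          (hnear x y hx (norm_coe_le_one y) hxz hy).1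
        have h2 := neg_abs_le (Real.log ((η / 2) ^ 2))
        have h3 := mul_nonneg hL0 (hφ0 y)
        linarith
    have iφ := integrable_of_continuous μ hφ
    have e1 : a * ((L - C) * m - 2 * L * I) - B * m =
        ∫ y, ((a * (L - C) - B) - a * (2 * L) * φ y) ∂(μ : Measure (ClosedUnitBall n)) := by
      rw [integral_sub (integrable_const _) (iφ.const_mul _), integral_const_mul, integral_const,
        smul_eq_mul]
      ring
    rw [e1]
    refine integral_mono ((integrable_const _).sub (iφ.const_mul _))
      (integrable_of_continuous μ (continuous_energyDensity_right a hq hx)) fun y => ?_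
    have h1 := mul_le_mul_of_nonneg_left (hbus y) ha.le
    have h2 := hB (‖moebius x y‖ ^ 2) ⟨by positivity,
      pow_le_one₀ (norm_nonneg _) (norm_moebius_le_one hx (norm_coe_le_one y))⟩
    have h3 := (abs_le.1 h2).1
    simp only [energyDensity]
    linarith
  have hpos : 0 < a * (m - 2 * I) := mul_pos ha (by linarith)
  have hev : ∀ᶠ x in 𝓝 z, 1 - ‖x‖ < Real.exp (-((K + a * C * m + B * m + 1) / (a * (m - 2 * I)))) := by
    have hc : Continuous fun x : EuclideanSpace ℝ (Fin n) => 1 - ‖x‖ := by fun_prop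
    refine hc.continuousAt.eventually (gt_mem_nhds ?_)
    simp only [hz, sub_self]
    exact Real.exp_pos _
  filter_upwards [hev, Metric.ball_mem_nhds z hδ] with x hx1 hx2 hx
  rw [mem_ball_iff_norm] at hx2
  have h1 := Real.log_lt_log (sub_pos.2 hx) hx1
  rw [Real.log_exp] at h1
  have h2 : (K + a * C * m + B * m + 1) / (a * (m - 2 * I)) < -Real.log (1 - ‖x‖) := by linarith
  rw [div_lt_iff₀ hpos] at h2
  have h3 := key x hx hx2
  linarith

/-- Existence of a center for the special radial profiles. -/
lemma exists_center_profile {a : ℝ} (ha : 0 < a) {q : ℝ → ℝ} (hq : Continuous q)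
    {μ : FiniteMeasure (ClosedUnitBall n)} (hadm : Admissible μ) :
    ∃ x, IsCenter (profile a q) μ x := by
  obtain ⟨r, hr0, hr1, hr⟩ : ∃ r : ℝ, 0 < r ∧ r < 1 ∧ ∀ x : EuclideanSpace ℝ (Fin n), r ≤ ‖x‖ →
      ‖x‖ < 1 → energy a q μ 0 < energy a q μ x := by
    by_contra! hcon
    have h1 : ∀ k : ℕ, ∃ x : EuclideanSpace ℝ (Fin n), 1 - 1 / ((k : ℝ) + 2) ≤ ‖x‖ ∧
        ‖x‖ < 1 ∧ energy a q μ x ≤ energy a q μ 0 := fun k => by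
      have : 1 / ((k : ℝ) + 2) < 1 := by
        rw [div_lt_one (by positivity)]; linarith [Nat.cast_nonneg (α := ℝ) k]
      exact hcon _ (by linarith) (sub_lt_self _ (by positivity))
    choose x hx1 hx2 hx3 using h1
    obtain ⟨z, -, ψ, hψ, hz⟩ := (isCompact_closedBall (0 : EuclideanSpace ℝ (Fin n)) 1).tendsto_subseq
      fun k => mem_closedBall_zero_iff.2 (hx2 k).le
    have hlim : Tendsto (fun k : ℕ => 1 - 1 / ((k : ℝ) + 2)) atTop (𝓝 1) := by
      have : Tendsto (fun k : ℕ => 1 / ((k : ℝ) + 2)) atTop (𝓝 0) :=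
        tendsto_const_nhds.div_atTop
          (tendsto_atTop_add_const_right _ _ tendsto_natCast_atTop_atTop)
      simpa using this.const_sub 1
    have hz1 : ‖z‖ = 1 := le_antisymm
      (le_of_tendsto' hz.norm fun k => (hx2 _).le)
      (le_of_tendsto_of_tendsto' (hlim.comp hψ.tendsto_atTop) hz.norm fun k => hx1 _)
    obtain ⟨k, hk⟩ := (hz.eventually (eventually_energy_gt ha hq hadm hz1 (energy a q μ 0))).exists
    exact absurd (hx3 (ψ k)) (not_le.2 (hk (hx2 _)))
  have hsub : Metric.closedBall (0 : EuclideanSpace ℝ (Fin n)) r ⊆ Metric.ball 0 1 :=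
    Metric.closedBall_subset_ball hr1
  obtain ⟨x, hx, hmin⟩ := (isCompact_closedBall (0 : EuclideanSpace ℝ (Fin n)) r).exists_isMinOn
    ⟨0, Metric.mem_closedBall_self hr0.le⟩ ((continuousOn_energy a hq μ).mono hsub)
  have hx1 : ‖x‖ < 1 := mem_ball_zero_iff.1 (hsub hx)
  -- The minimum over the closed ball of radius `r` is one over the open unit ball, because outside
  -- radius `r` the energy exceeds its value at 0.
  refine ⟨x, isCenter_of_isLocalMin a hq hx1 ?_⟩
  filter_upwards [Metric.isOpen_ball.mem_nhds (hsub hx)] with y hy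
  rcases le_or_gt ‖y‖ r with h | h
  · exact hmin (mem_closedBall_zero_iff.2 h)
  · exact (hmin (Metric.mem_closedBall_self hr0.le)).trans (hr y h.le (mem_ball_zero_iff.1 hy)).le

/-! ### Approximation and existence for general profiles -/

/-- The special profiles are uniformly dense among those with a prescribed value at `1`. -/
lemma exists_profile_approx {g : ℝ → ℝ} (hg : Continuous g) (hg0 : g 0 = 0) {δ : ℝ} (hδ : 0 < δ) :
    ∃ q : ℝ → ℝ, Continuous q ∧ ∀ t ∈ Set.Icc (0 : ℝ) 1, |profile (g 1) q t - g t| ≤ δ := by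
  let f : ℝ → ℝ := fun t => g t - t * g 1
  let w : ℝ → ℝ := fun t => t ^ 2 * (1 - t ^ 2) ^ 2
  have hf : Continuous f := by fun_prop
  have hw : Continuous w := by fun_prop
  have hw0 : ∀ t, 0 ≤ w t := fun t => by positivity
  obtain ⟨M, hM⟩ := (isCompact_Icc (a := (0 : ℝ)) (b := 1)).exists_bound_of_continuousOn
    hf.continuousOn
  have hM0 : 0 ≤ M := (norm_nonneg _).trans (hM 0 (by simp))
  -- `f` vanishes at 0 and 1, the only zeros of `w` on [0, 1], so `w` has a positive lower bound on
  -- the compact set where |f| ≥ δ.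
  obtain ⟨c, hc, hcw⟩ : ∃ c > 0, ∀ t ∈ Set.Icc (0 : ℝ) 1, δ ≤ |f t| → c ≤ w t := by
    have hK : IsCompact (Set.Icc (0 : ℝ) 1 ∩ {t | δ ≤ |f t|}) :=
      isCompact_Icc.inter_right (isClosed_le continuous_const hf.abs)
    obtain ⟨c, hc, h⟩ := hK.exists_forall_le' (a := 0) hw.continuousOn fun t ht => by
      refine (hw0 t).lt_of_ne fun h => ?_
      have h1 : t = 0 ∨ t = 1 := by
        rcases mul_eq_zero.1 h.symm with h | h
        · exact Or.inl (by simpa using h)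
        · have : 1 - t ^ 2 = 0 := by simpa using h
          exact Or.inr (by nlinarith [ht.1.1])
      have h2 : δ ≤ |f t| := ht.2
      rcases h1 with rfl | rfl <;> simp [f, hg0] at h2 <;> linarith
    exact ⟨c, hc, fun t h1 h2 => h t ⟨h1, h2⟩⟩
  set ε := c * δ / (M + 1) with hε
  have hε0 : 0 < ε := by positivity
  -- Dividing `f` by t(1 - t²) would be exact but singular; the regularized quotient leaves the
  -- error f ε/(w + ε). Where |f| ≥ δ this is at most M ε/c ≤ δ by the choice of `ε`.
  refine ⟨fun ρ => f √ρ * √ρ * (1 - ρ) / (|ρ| * (1 - ρ) ^ 2 + ε), ?_, fun t ht => ?_⟩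
  · refine Continuous.div (by fun_prop) (by fun_prop) fun ρ => ?_
    positivity
  · have hwt := hw0 t
    have e : profile (g 1) (fun ρ => f √ρ * √ρ * (1 - ρ) / (|ρ| * (1 - ρ) ^ 2 + ε)) t - g t =
        -(f t * ε / (w t + ε)) := by
      have h1 : g t = f t + t * g 1 := by simp only [f]; ring
      simp only [profile]
      rw [Real.sqrt_sq ht.1, abs_of_nonneg (sq_nonneg t), h1]
      have h2 : t ^ 2 * (1 - t ^ 2) ^ 2 + ε ≠ 0 := by positivity
      simp only [w]
      field_simp
      ring
    rw [e, abs_neg, abs_div, abs_mul, abs_of_pos hε0, abs_of_pos (by positivity : 0 < w t + ε),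
      div_le_iff₀ (by positivity)]
    rcases lt_or_ge |f t| δ with h | h
    · nlinarith
    · have h1 := hcw t ht h
      have h2 : |f t| ≤ M := hM t ht
      have h3 : ε * (M + 1) = c * δ := by rw [hε]; field_simp
      nlinarith [mul_le_mul_of_nonneg_right h2 hε0.le]

/-- Existence of a center for continuous profiles. -/
theorem exists_center {g : ℝ → ℝ} (hg : Continuous g) (hg0 : g 0 = 0) (hg1 : 0 < g 1)
    {μ : FiniteMeasure (ClosedUnitBall n)} (hadm : Admissible μ) : ∃ x, IsCenter g μ x := by
  choose q hq hqg using fun k : ℕ =>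
    exists_profile_approx hg hg0 (Nat.one_div_pos_of_nat (α := ℝ) (n := k))
  choose x hx using fun k : ℕ => exists_center_profile hg1 (hq k) hadm
  have hb : ∀ k, ‖x k‖ < 1 := fun k => mem_ball_zero_iff.1 (hx k).1
  obtain ⟨z, hz1, ψ, hψ, hz⟩ := (isCompact_closedBall (0 : EuclideanSpace ℝ (Fin n)) 1).tendsto_subseq
    fun k => mem_closedBall_zero_iff.2 (hb k).le
  have hε := (tendsto_one_div_add_atTop_nhds_zero_nat (𝕜 := ℝ)).comp hψ.tendsto_atTop
  rcases (mem_closedBall_zero_iff.1 hz1).lt_or_eq with h | h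
  · exact ⟨z, isCenter_of_tendsto hg hg0 (fun k => continuous_profile _ (hq (ψ k)))
      (fun k => profile_zero _ _) hε (fun k => hqg (ψ k)) tendsto_const_nhds h hz
      fun k => hx (ψ k)⟩
  · exact absurd hz (not_tendsto_boundary_of_approx hg hg0 hg1
      (fun k => continuous_profile _ (hq (ψ k))) (fun k => profile_zero _ _) hε
      (fun k => hqg (ψ k)) hadm h fun k => hx (ψ k))

/-! ### Continuous dependence and assembly -/

/-- Centers depend continuously on the measure, for monotone profiles. -/
theorem tendsto_center {g : ℝ → ℝ} (hg : Continuous g) (hg0 : g 0 = 0) (hg1 : 0 < g 1)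
    (hmono : MonotoneOn g (Set.Icc 0 1)) {μ : FiniteMeasure (ClosedUnitBall n)}
    (hadm : Admissible μ) {μs : ℕ → FiniteMeasure (ClosedUnitBall n)}
    (hμ : Tendsto μs atTop (𝓝 μ)) {x : EuclideanSpace ℝ (Fin n)}
    {xs : ℕ → EuclideanSpace ℝ (Fin n)} (huniq : ∀ z, IsCenter g μ z → z = x)
    (hc : ∀ k, IsCenter g (μs k) (xs k)) : Tendsto xs atTop (𝓝 x) := by
  have hb : ∀ k, ‖xs k‖ < 1 := fun k => mem_ball_zero_iff.1 (hc k).1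
  refine tendsto_of_subseq_tendsto fun ns hns => ?_
  obtain ⟨z, hz1, ψ, hψ, hz⟩ := (isCompact_closedBall (0 : EuclideanSpace ℝ (Fin n)) 1).tendsto_subseq
    fun k => mem_closedBall_zero_iff.2 (hb (ns k)).le
  have hμ' := hμ.comp (hns.comp hψ.tendsto_atTop)
  refine ⟨ψ, ?_⟩
  rcases (mem_closedBall_zero_iff.1 hz1).lt_or_eq with h | h
  · have hzc := isCenter_of_tendsto hg hg0 (gs := fun _ => g) (fun _ => hg) (fun _ => hg0)
      (ε := fun _ => 0) tendsto_const_nhds (fun _ t _ => by simp) hμ' h hz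
      fun k => hc (ns (ψ k))
    rw [← huniq z hzc]
    exact hz
  · exact absurd hz (not_tendsto_boundary_of_monotone hg hg0 hmono hg1 hadm hμ' h
      fun k => hc (ns (ψ k)))

/-- `T_x` maps the closed ball into itself, so the field evaluates the profile only on [0, 1]. -/
lemma isCenter_congr {g G : ℝ → ℝ} (h : Set.EqOn g G (Set.Icc 0 1))
    (μ : FiniteMeasure (ClosedUnitBall n)) (x : EuclideanSpace ℝ (Fin n)) :
    IsCenter g μ x ↔ IsCenter G μ x := by
  refine and_congr_right fun hx => ?_
  have e : centerField g μ x = centerField G μ x := by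
    unfold centerField
    congr 1
    ext1 y
    rw [radialField_eq, radialField_eq, h ⟨norm_nonneg _,
      norm_moebius_le_one (mem_ball_zero_iff.1 hx) (norm_coe_le_one y)⟩]
  rw [e]

end HypCenter

open HypCenter in
theorem mainTheorem2 (n : ℕ) (hn : 1 ≤ n) (g : ℝ → ℝ)
    (hg : ContinuousOn g (Set.Icc 0 1)) (hg0 : g 0 = 0)
    (μ : FiniteMeasure (HypCenter.ClosedUnitBall n)) (hμ : HypCenter.Admissible μ) :
    -- (a) existence
    (0 < g 1 → ∃ x : EuclideanSpace ℝ (Fin n), HypCenter.IsCenter g μ x) ∧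
    -- (b) uniqueness
    (HypCenter.CondI g ∨ HypCenter.CondII g μ →
      ∃! x : EuclideanSpace ℝ (Fin n), HypCenter.IsCenter g μ x) ∧
    -- (c) continuous dependence
    (∀ μs : ℕ → FiniteMeasure (HypCenter.ClosedUnitBall n),
      (∀ k, HypCenter.Admissible (μs k)) → Tendsto μs atTop (𝓝 μ) →
      HypCenter.CondI g ∨ (HypCenter.CondII g μ ∧ ∀ k, HypCenter.CondII g (μs k)) →
      ∀ (x : EuclideanSpace ℝ (Fin n)) (xs : ℕ → EuclideanSpace ℝ (Fin n)),
        HypCenter.IsCenter g μ x → (∀ k, HypCenter.IsCenter g (μs k) (xs k)) →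
        Tendsto xs atTop (𝓝 x)) := by
  -- Extending `g` by constants outside [0, 1] gives a globally continuous profile with the same
  -- centers.
  let G : ℝ → ℝ := Set.IccExtend zero_le_one ((Set.Icc (0 : ℝ) 1).domRestrict g)
  have hG : Continuous G := hg.domRestrict.Icc_extend'
  have hgG : Set.EqOn g G (Set.Icc 0 1) := fun t ht => 
    (Set.IccExtend_of_mem zero_le_one ((Set.Icc (0 : ℝ) 1).domRestrict g) ht).symm
  have hG0 : G 0 = 0 := by rw [← hgG (by simp), hg0]
  have hG1 : g 1 = G 1 := hgG (by simp)
  have hI : CondI g → CondI G := fun h => h.congr hgG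
  have hII : CondII g μ → CondII G μ := fun h =>
    ⟨h.1.congr hgG, fun r hr => hgG ⟨hr.1.le, hr.2.le⟩ ▸ h.2.1 r hr, h.2.2⟩
  have hpos : CondI G ∨ CondII G μ → 0 < G 1 := fun h =>
    h.elim (fun h => pos_of_condI hG0 h 1 (by simp)) fun h => pos_of_condII h 1 (by simp)
  simp only [isCenter_congr hgG]
  refine ⟨fun h => exists_center hG hG0 (hG1 ▸ h) hμ, fun h => ?_, ?_⟩
  · have h' := h.imp hI hII
    obtain ⟨x, hx⟩ := exists_center hG hG0 (hpos h') hμ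
    exact ⟨x, hx, fun y hy => center_unique hG hG0 hμ h' hy hx⟩
  · intro μs _ hlim h x xs hx hxs
    have h' : CondI G ∨ CondII G μ := h.imp hI fun h => hII h.1
    exact tendsto_center hG hG0 (hpos h') (h'.elim (fun h => h.monotoneOn) fun h => h.1) hμ hlim
      (fun z hz => center_unique hG hG0 hμ h' hz hx) hxs
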